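/- Let $\mathbf{F}_q$ be a finite field of characteristic $p$, let $\mathbf{Z}_q=W(\mathbf{F}_q)$ be its ring of Witt vectors and $\mathbf{Q}_q$ the fraction field of $\mathbf{Z}_q$. Let $Q\in\mathbf{F}_q[x,y]$ be irreducible and monic in $y$, and let $\mathcal{Q}\in\mathbf{Z}_q[x,y]$ be a lift of $Q$ that is monic in $y$ and has the same monomials in its support as $Q$. Write $\mathbf{Q}_q(x,y)=\mathbf{Q}_q(x)[y]/(\mathcal{Q})$ for the function field of the curve $\mathcal{Q}=0$. Let $a,b$ be positive integers and let $\Gamma\subset\mathbf{R}^2$ be the triangle with vertices $(0,0)$, $(a,0)$, $(0,b)$. Suppose that $Q=\sum c_{ij}x^iy^j$ is nondegenerate with respect to $\Gamma$: every $(i,j)$ with $c_{ij}\neq0$ lies in $\Gamma$, and for every face $\gamma$ of $\Gamma$ (the vertices, the edges, and $\Gamma$ itself), writing $Q_\gamma=\sum_{(i,j)\in\gamma}c_{ij}x^iy^j$, the system $Q_\gamma=\partial Q_\gamma/\partial x=\partial Q_\gamma/\partial y=0$ has no solution in $(\overline{\mathbf{F}}_q^{\,\times})^2$. Then $\deg_y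 Q=b$, and $$\left[1,\ x^{\lfloor -a/b\rfloor}y,\ x^{\lfloor -2a/b\rfloor}y^2,\ \dots,\ x^{\lfloor -(b-1)a/b\rfloor}y^{b-1}\right]$$ is an integral basis for $\mathbf{Q}_q(x,y)$ over $\mathbf{Q}_q[x^{-1}]$, that is, a basis, as a $\mathbf{Q}_q[x^{-1}]$-module, of the integral closure of $\mathbf{Q}_q[x^{-1}]$ in $\mathbf{Q}_q(x,y)$. Moreover there is a matrix $W^\infty\in GL_b(\mathbf{Z}_q[x,x^{-1}])$ (with rows and columns indexed by $0,\dots,b-1$) such that $\sum_{i=0}^{b-1}W^\infty_{ij}\,y^i=x^{\lfloor -ja/b\rfloor}y^j$ for all $0\le j\le b-1$. -/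

import Mathlib

open Polynomial
open scoped Polynomial.Bivariate LaurentPolynomial

noncomputable section

/-! Bivariate polynomials are elements of `k[X][Y]`: the coefficient of `x ^ i * y ^ j` in `f`
is `(f.coeff j).coeff i`. -/

/-- The partial derivative with respect to the inner variable `x`. -/
def partialX {k : Type*} [CommRing k] (f : k[X][Y]) : k[X][Y] :=
  f.sum fun j c => monomial j (derivative c)

/-- The partial derivative with respect to the outer variable `y`. -/
def partialY {k : Type*} [CommRing k] (f : k[X][Y]) : k[X][Y] :=
  derivative f

open Classical in
/-- `f_γ`: the sum of the terms of `f` whose exponent `(i, j)` lies in the plane set `γ`. -/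
def restrictTo {k : Type*} [CommRing k] (f : k[X][Y]) (γ : Set (ℝ × ℝ)) : k[X][Y] :=
  f.sum fun j c => c.sum fun i r =>
    if ((i : ℝ), (j : ℝ)) ∈ γ then monomial j (monomial i r) else 0

/-- The value `f(u, v)` at a point with coordinates in an algebra over the coefficient ring. -/
def valueAt {k A : Type*} [CommRing k] [CommRing A] [Algebra k A] (u v : A) (f : k[X][Y]) : A :=
  (f.map (mapRingHom (algebraMap k A))).evalEval u v

/-- `f` is nondegenerate with respect to the convex lattice polygon `Γ`: its support lies in `Γ`,
and for every face `γ` of `Γ` (the vertices, the edges and `Γ` itself, that is, the nonempty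
exposed subsets of the polygon) the equations `f_γ = ∂f_γ/∂x = ∂f_γ/∂y = 0` have no common
solution in the torus over an algebraic closure of `k`. -/
def IsNondegenerate {k : Type*} [Field k] (f : k[X][Y]) (Γ : Set (ℝ × ℝ)) : Prop :=
  (∀ i j : ℕ, (f.coeff j).coeff i ≠ 0 → ((i : ℝ), (j : ℝ)) ∈ Γ) ∧
  ∀ γ : Set (ℝ × ℝ), γ.Nonempty → IsExposed ℝ Γ γ →
    ∀ u v : AlgebraicClosure k, u ≠ 0 → v ≠ 0 →
      ¬ (valueAt u v (restrictTo f γ) = 0 ∧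
         valueAt u v (partialX (restrictTo f γ)) = 0 ∧
         valueAt u v (partialY (restrictTo f γ)) = 0)

/-- The triangle with vertices `(0, 0)`, `(a, 0)` and `(0, b)`. -/
def triangle (a b : ℕ) : Set (ℝ × ℝ) :=
  convexHull ℝ {((0 : ℝ), (0 : ℝ)), ((a : ℝ), (0 : ℝ)), ((0 : ℝ), (b : ℝ))}

/-- `IsIntegralBasis R b`: the family `b` in the `R`-algebra `L` is a basis, as an `R`-module,
of the integral closure of `R` in `L`. -/
def IsIntegralBasis (R : Type*) {L ι : Type*} [CommRing R] [CommRing L] [Algebra R L]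
    (b : ι → L) : Prop :=
  LinearIndependent R b ∧
    Submodule.span R (Set.range b) = Subalgebra.toSubmodule (integralClosure R L)

section Lift

variable (p : ℕ) [Fact p.Prime] (F : Type*) [Field F] [CharP F p]

/-- `ℤ_q`, for the finite field `F` with `q` elements: the Witt vectors of `F`. -/
abbrev Zq : Type _ := WittVector p F

/-- `ℚ_q`, the field of fractions of `ℤ_q`. -/
abbrev Qq : Type _ := FractionRing (Zq p F)

/-- Coefficientwise reduction modulo `p` from `ℤ_q[x, y]` to `F[x, y]`. -/
def reduceMod : (Zq p F)[X][Y] →+* F[X][Y] :=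
  mapRingHom (mapRingHom (WittVector.constantCoeff : WittVector p F →+* F))

variable {p F}

/-- `f`, a polynomial with coefficients in `ℤ_q`, as a polynomial in `y` over `ℚ_q(x)`. -/
def overRatFunc (f : (Zq p F)[X][Y]) : (RatFunc (Qq p F))[X] :=
  f.map ((algebraMap (Qq p F)[X] (RatFunc (Qq p F))).comp
    (mapRingHom (algebraMap (Zq p F) (Qq p F))))

/-- The function field `ℚ_q(x, y) = ℚ_q(x)[y] / (f)` of the curve `f = 0`. -/
abbrev CurveFunctionField (f : (Zq p F)[X][Y]) : Type _ := AdjoinRoot (overRatFunc f)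

/-- The element `x ^ m`, for an integer `m`, of the function field. -/
def xPow (f : (Zq p F)[X][Y]) (m : ℤ) : CurveFunctionField f :=
  algebraMap (RatFunc (Qq p F)) (CurveFunctionField f) (RatFunc.X ^ m)

/-- The element `y` of the function field. -/
def yElt (f : (Zq p F)[X][Y]) : CurveFunctionField f := AdjoinRoot.root (overRatFunc f)

/-- The subring `ℚ_q[x⁻¹]` of the function field. -/
def polyInvX (f : (Zq p F)[X][Y]) : Subalgebra (Qq p F) (CurveFunctionField f) :=
  Algebra.adjoin (Qq p F) {xPow f (-1)}

/-- A Laurent polynomial in `ℤ_q[x, x⁻¹]` as an element of the function field. -/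
def laurentElt (f : (Zq p F)[X][Y]) : (Zq p F)[T;T⁻¹] →+* CurveFunctionField f :=
  (algebraMap (RatFunc (Qq p F)) (CurveFunctionField f)).comp
    (LaurentPolynomial.eval₂ (algebraMap (Zq p F) (RatFunc (Qq p F)))
      (Units.mk0 RatFunc.X RatFunc.X_ne_zero))

/-- When `f` is monic in `y` with irreducible reduction, the function field is a field. -/
theorem isField_curveFunctionField [Finite F] {f : (Zq p F)[X][Y]} (hf : f.Monic)
    (h : Irreducible (reduceMod p F f)) : IsField (CurveFunctionField f) := by
  have h1 : Irreducible f := hf.irreducible_of_irreducible_map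
    (mapRingHom (WittVector.constantCoeff : WittVector p F →+* F)) f h
  let φ : (Zq p F)[X] →+* RatFunc (Qq p F) :=
    (algebraMap (Qq p F)[X] (RatFunc (Qq p F))).comp (mapRingHom (algebraMap (Zq p F) (Qq p F)))
  let _ : Algebra (Zq p F)[X] (RatFunc (Qq p F)) := φ.toAlgebra
  have hinj : Function.Injective φ :=
    (IsFractionRing.injective (Qq p F)[X] (RatFunc (Qq p F))).comp
      (Polynomial.map_injective _ (IsFractionRing.injective (Zq p F) (Qq p F)))
  have : FaithfulSMul (Zq p F)[X] (RatFunc (Qq p F)) :=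
    (faithfulSMul_iff_algebraMap_injective _ _).mpr hinj
  have key : ∀ u : (Qq p F)[X], ∃ v : (Zq p F)[X], ∃ c : Zq p F, c ≠ 0 ∧
      φ v = φ (C c) * algebraMap (Qq p F)[X] (RatFunc (Qq p F)) u := by
    intro u
    obtain ⟨c, hc, hcu⟩ := IsLocalization.integerNormalization_spec
      (nonZeroDivisors (Zq p F)) u
    refine ⟨IsLocalization.integerNormalization (nonZeroDivisors (Zq p F)) u, c,
      nonZeroDivisors.ne_zero hc, ?_⟩
    have e : mapRingHom (algebraMap (Zq p F) (Qq p F))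
        (IsLocalization.integerNormalization (nonZeroDivisors (Zq p F)) u)
        = mapRingHom (algebraMap (Zq p F) (Qq p F)) (C c) * u := by
      rw [coe_mapRingHom, hcu, Polynomial.map_C, Algebra.smul_def]
      rfl
    simp only [φ, RingHom.comp_apply]
    rw [e, map_mul]
  have : IsFractionRing (Zq p F)[X] (RatFunc (Qq p F)) := by
    refine IsFractionRing.of_field _ _ fun z => ?_
    obtain ⟨u, w, hw, rfl⟩ := IsFractionRing.div_surjective (A := (Qq p F)[X]) z
    obtain ⟨v, c, hc, hv⟩ := key u
    obtain ⟨v', c', hc', hv'⟩ := key w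
    have hφ : ∀ d : Zq p F, d ≠ 0 → φ (C d) ≠ 0 := fun d hd =>
      (map_ne_zero_iff φ hinj).mpr (C_ne_zero.mpr hd)
    have hw0 : algebraMap (Qq p F)[X] (RatFunc (Qq p F)) w ≠ 0 :=
      (map_ne_zero_iff _ (IsFractionRing.injective (Qq p F)[X] (RatFunc (Qq p F)))).mpr
        (nonZeroDivisors.ne_zero hw)
    refine ⟨C c' * v, C c * v', ?_⟩
    change _ = φ (C c' * v) / φ (C c * v')
    rw [map_mul, map_mul, hv, hv']
    have := hφ c hc
    have := hφ c' hc'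
    field_simp
  have h2 : Irreducible (overRatFunc f) :=
    (hf.irreducible_iff_irreducible_map_fraction_map (K := RatFunc (Qq p F))).mp h1
  have : Fact (Irreducible (overRatFunc f)) := ⟨h2⟩
  exact Field.toIsField (AdjoinRoot (overRatFunc f))

end Lift

end

/-!
The curve is normal, both in the affine plane and along the divisor at infinity of the weighted
compactification in which `x` has weight `b` and `y` has weight `a`; hence an element of the
function field that is integral over `K[x⁻¹]` is a Laurent polynomial in `x` and a polynomial in `y`
all of whose monomials have nonpositive weight, and these monomials are generated by the elements
of the proposed basis.

Write `f` for the equation over `K = ℚ_q`. Nondegeneracy on the faces of the triangle says that the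
reduction of the curve is smooth in the affine plane (`IsNondegenerate.span_eq_top`) and
transversal to the divisor at infinity (`IsNondegenerate.span_edge_eq_top`). Smoothness passes to
the generic fibre, because the compactified curve is proper: a singular point `(u, v)` of `f = 0`
specializes, with respect to a valuation ring of a field containing its coordinates, either to an
affine singular point or, if `u` is not integral, to a singular point at infinity. The limit at
infinity is computed in the coordinates `σ = x ^ (-1 / b)` and `t = y * σ ^ a`, in which the
equation becomes `weightedReflect (a * b) a b f`, monic in `t`. This gives
`span_eq_top_of_isNondegenerate_map` and, in the same way, separability of the edge polynomial over
`K`, `separable_edge_of_isNondegenerate_map`.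

Affine normality rests on the fact that `f` is monic in `y` and, up to a constant, in `x`. By
Euler's formula for the dual of a monogenic order, `∂f/∂y` and `∂f/∂x` both multiply the integral
closure of `K[x, y]` into `K[x, y]`; since `f`, `∂f/∂x` and `∂f/∂y` generate the unit ideal, the two
rings agree (`mem_adjoin_of_isIntegral`). At infinity, the extension by `σ` makes the curve
unramified over `σ = 0`, where its fibre is defined by the separable edge polynomial; a reduced
fibre forces normality (`exists_aeval_eq_of_isIntegral`), and this bounds the weights of an integral
element (`weight_le_of_isIntegral`). Conversely, the equation of the curve rewrites every monomial
of nonpositive weight in terms of the basis (`xZPow_mul_pow_mem_span`), so that the basis spans a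
ring that is finite over `K[x⁻¹]`.
-/

/-! ### Evaluation of bivariate polynomials -/

section Evaluation

variable {R A B : Type*} [CommRing R] [CommRing A] [CommRing B]

/-- The value at `(u, v)` of a bivariate polynomial, its coefficients being mapped by `φ`. -/
noncomputable def evalAt (φ : R →+* A) (u v : A) : R[X][Y] →+* A :=
  eval₂RingHom (eval₂RingHom φ u) v

theorem evalAt_eq_sum (φ : R →+* A) (u v : A) (f : R[X][Y]) :
    evalAt φ u v f = f.sum fun j c => c.sum fun i r => φ r * u ^ i * v ^ j := by
  simp only [evalAt, coe_eval₂RingHom, eval₂_eq_sum, Polynomial.sum_def, Finset.sum_mul]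

@[simp] theorem evalAt_X (φ : R →+* A) (u v : A) : evalAt φ u v X = v := by simp [evalAt]

@[simp] theorem evalAt_C (φ : R →+* A) (u v : A) (c : R[X]) :
    evalAt φ u v (C c) = c.eval₂ φ u := by simp [evalAt]

theorem evalAt_monomial_monomial (φ : R →+* A) (u v : A) (i j : ℕ) (r : R) :
    evalAt φ u v (monomial j (monomial i r)) = φ r * u ^ i * v ^ j := by
  simp [evalAt, eval₂_monomial]

theorem map_evalAt (ψ : A →+* B) (φ : R →+* A) (u v : A) (f : R[X][Y]) :
    ψ (evalAt φ u v f) = evalAt (ψ.comp φ) (ψ u) (ψ v) f := by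
  simp only [evalAt_eq_sum, Polynomial.sum_def, map_sum, map_mul, map_pow, RingHom.comp_apply]

theorem evalAt_map {S : Type*} [CommRing S] (ρ : R →+* S) (φ : S →+* A) (u v : A) (f : R[X][Y]) :
    evalAt φ u v (f.map (mapRingHom ρ)) = evalAt (φ.comp ρ) u v f := by
  simp only [evalAt, coe_eval₂RingHom, eval₂_map]
  congr 1
  ext <;> simp

theorem valueAt_eq_evalAt [Algebra R A] (u v : A) (f : R[X][Y]) :
    valueAt u v f = evalAt (algebraMap R A) u v f :=
  (eval₂_eval₂RingHom_apply _ _ _ _).symm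

theorem evalAt_C_X (g : R[X][Y]) : evalAt (C.comp C) (C X) X g = g := by
  rw [evalAt_eq_sum]
  conv_rhs => rw [← sum_C_mul_X_pow_eq g]
  refine Finset.sum_congr rfl fun j _ => ?_
  dsimp only
  conv_rhs => rw [← sum_C_mul_X_pow_eq (g.coeff j)]
  simp only [Polynomial.sum_def, map_sum, map_mul, map_pow, Finset.sum_mul, RingHom.comp_apply]

theorem ext_coeff_coeff {f g : R[X][Y]} (h : ∀ i j, (f.coeff j).coeff i = (g.coeff j).coeff i) :
    f = g := by
  ext j i
  exact h i j

end Evaluation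

section Coefficients

variable {R : Type*} [CommRing R]

theorem coeff_partialX (f : R[X][Y]) (j : ℕ) :
    (partialX f).coeff j = derivative (f.coeff j) := by
  rw [partialX, Polynomial.sum_def, finsetSum_coeff]
  simp only [coeff_monomial]
  rw [Finset.sum_ite_eq']
  split_ifs with h
  · rfl
  · rw [notMem_support_iff.mp h, derivative_zero]

theorem coeff_coeff_partialX (f : R[X][Y]) (i j : ℕ) :
    ((partialX f).coeff j).coeff i = (f.coeff j).coeff (i + 1) * (i + 1) := by
  rw [coeff_partialX, coeff_derivative]

theorem coeff_coeff_partialY (f : R[X][Y]) (i j : ℕ) :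
    ((partialY f).coeff j).coeff i = (f.coeff (j + 1)).coeff i * (j + 1) := by
  rw [partialY, coeff_derivative]
  exact_mod_cast Polynomial.coeff_mul_natCast (p := f.coeff (j + 1)) (a := j + 1) (k := i)

theorem partialX_map {S : Type*} [CommRing S] (ρ : R →+* S) (f : R[X][Y]) :
    partialX (f.map (mapRingHom ρ)) = (partialX f).map (mapRingHom ρ) := by
  refine ext_coeff_coeff fun i j => ?_
  simp [coeff_partialX, derivative_map, coeff_derivative]

theorem partialY_map {S : Type*} [CommRing S] (ρ : R →+* S) (f : R[X][Y]) :
    partialY (f.map (mapRingHom ρ)) = (partialY f).map (mapRingHom ρ) :=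
  derivative_map _ _

open Classical in
theorem coeff_coeff_restrictTo (f : R[X][Y]) (γ : Set (ℝ × ℝ)) (i j : ℕ) :
    ((restrictTo f γ).coeff j).coeff i =
      if ((i : ℝ), (j : ℝ)) ∈ γ then (f.coeff j).coeff i else 0 := by
  have h1 : ∀ j' : ℕ, (((f.coeff j').sum fun i' r => if ((i' : ℝ), (j' : ℝ)) ∈ γ then
      (monomial j' (monomial i' r) : R[X][Y]) else 0).coeff j).coeff i =
      if j' = j then (if ((i : ℝ), (j : ℝ)) ∈ γ then (f.coeff j).coeff i else 0) else 0 := by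
    intro j'
    rw [Polynomial.sum_def, finsetSum_coeff, finsetSum_coeff]
    rw [Finset.sum_congr rfl (g := fun i' => if i' = i then (if j' = j then
      (if ((i : ℝ), (j : ℝ)) ∈ γ then (f.coeff j).coeff i else 0) else 0) else 0)]
    · rw [Finset.sum_ite_eq']
      by_cases hj : j' = j
      · subst hj
        by_cases hi : i ∈ (f.coeff j').support
        · simp [hi]
        · simp [notMem_support_iff.mp hi]
      · simp [hj]
    · intro i' _
      by_cases hj : j' = j
      · subst hj
        by_cases hi : i' = i
        · subst hi
          by_cases hm : ((i' : ℝ), (j' : ℝ)) ∈ γ <;> simp [hm]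
        · by_cases hm : ((i' : ℝ), (j' : ℝ)) ∈ γ <;> simp [hm, coeff_monomial, hi]
      · by_cases hm : ((i' : ℝ), (j' : ℝ)) ∈ γ <;> simp [hm, coeff_monomial, hj]
  rw [restrictTo, Polynomial.sum_def, finsetSum_coeff, finsetSum_coeff,
    Finset.sum_congr rfl fun j' _ => h1 j', Finset.sum_ite_eq']
  split_ifs with h2 h3 <;> first | rfl | skip
  rw [notMem_support_iff.mp h2, coeff_zero]

@[elab_as_elim]
theorem bivariate_induction {motive : R[X][Y] → Prop} (f : R[X][Y])
    (add : ∀ f g, motive f → motive g → motive (f + g))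
    (monomial : ∀ (i j : ℕ) (r : R), motive (monomial j (monomial i r))) : motive f := by
  induction f using Polynomial.induction_on' with
  | add f g hf hg => exact add f g hf hg
  | monomial j c =>
    induction c using Polynomial.induction_on' with
    | add c d hc hd => rw [map_add]; exact add _ _ hc hd
    | monomial i r => exact monomial i j r

theorem coeff_coeff_swap (f : R[X][Y]) (i j : ℕ) :
    ((Bivariate.swap f).coeff i).coeff j = (f.coeff j).coeff i := by
  induction f using bivariate_induction with
  | add f g hf hg => simp [hf, hg]
  | monomial i' j' r =>
    rw [Bivariate.swap_monomial_monomial]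
    simp only [coeff_monomial]
    split_ifs <;> simp_all [coeff_monomial]

theorem partialX_eq_swap_derivative_swap (f : R[X][Y]) :
    partialX f = Bivariate.swap (derivative (Bivariate.swap f)) := by
  refine ext_coeff_coeff fun i j => ?_
  rw [coeff_coeff_swap, coeff_coeff_partialX, ← coeff_coeff_swap]
  exact (coeff_coeff_partialY (Bivariate.swap f) j i).symm

theorem evalAt_swap {A : Type*} [CommRing A] (φ : R →+* A) (u v : A) (f : R[X][Y]) :
    evalAt φ v u (Bivariate.swap f) = evalAt φ u v f := by
  induction f using bivariate_induction with
  | add f g hf hg => simp [hf, hg]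
  | monomial i j r =>
    rw [Bivariate.swap_monomial_monomial, evalAt_monomial_monomial, evalAt_monomial_monomial]
    ring

theorem evalAt_restrictTo {A : Type*} [CommRing A] (φ : R →+* A) (u v : A) (f : R[X][Y])
    (γ : Set (ℝ × ℝ)) [DecidablePred (· ∈ γ)] : evalAt φ u v (restrictTo f γ) =
      f.sum fun j c => c.sum fun i r =>
        if ((i : ℝ), (j : ℝ)) ∈ γ then φ r * u ^ i * v ^ j else 0 := by
  simp only [restrictTo, Polynomial.sum_def, map_sum]
  refine Finset.sum_congr rfl fun j _ => Finset.sum_congr rfl fun i _ => ?_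
  split_ifs
  · rw [evalAt_monomial_monomial]
  · rw [map_zero]

end Coefficients

/-! ### Weighted reflection of polynomials supported in a triangle -/

section WeightedReflect

variable {R A : Type*} [CommRing R] [CommRing A]

/-- The support of `f` lies in the triangle with vertices `(0, 0)`, `(a, 0)`, `(0, b)`. -/
def SupportedInTriangle (a b : ℕ) (f : R[X][Y]) : Prop :=
  ∀ i j, (f.coeff j).coeff i ≠ 0 → b * i + a * j ≤ a * b

/-- The polynomial `σ ^ N * f(σ ^ (-b), σ ^ (-a) * t)` in `σ` (inner variable) and `t` (outer
variable), if `b * i + a * j ≤ N` on the support of `f`. For `N = a * b` and `f` supported in the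
triangle, its value at `σ = 0` is the part of `f` on the hypotenuse, dehomogenized. -/
noncomputable def weightedReflect (N a b : ℕ) (f : R[X][Y]) : R[X][Y] :=
  f.sum fun j c => monomial j (c.sum fun i r => monomial (N - b * i - a * j) r)

theorem weightedReflect_add (N a b : ℕ) (f g : R[X][Y]) :
    weightedReflect N a b (f + g) = weightedReflect N a b f + weightedReflect N a b g := by
  refine sum_add_index _ _ _ (by simp) fun j c d => ?_
  rw [← map_add]
  congr 1
  exact sum_add_index _ _ _ (by simp) fun i r s => map_add _ _ _

theorem weightedReflect_monomial_monomial (N a b i j : ℕ) (r : R) :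
    weightedReflect N a b (monomial j (monomial i r)) =
      monomial j (monomial (N - b * i - a * j) r) := by
  rw [weightedReflect, sum_monomial_index _ _ (by simp), sum_monomial_index _ _ (by simp)]

theorem coeff_weightedReflect (N a b : ℕ) (f : R[X][Y]) (j : ℕ) :
    (weightedReflect N a b f).coeff j =
      (f.coeff j).sum fun i r => monomial (N - b * i - a * j) r := by
  rw [weightedReflect, Polynomial.sum_def, finsetSum_coeff]
  simp only [coeff_monomial]
  rw [Finset.sum_ite_eq']
  split_ifs with h
  · rfl
  · rw [notMem_support_iff.mp h, sum_zero_index]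

theorem weightedReflect_map {S : Type*} [CommRing S] (ρ : R →+* S) (N a b : ℕ) (f : R[X][Y]) :
    weightedReflect N a b (f.map (mapRingHom ρ)) =
      (weightedReflect N a b f).map (mapRingHom ρ) := by
  induction f using bivariate_induction with
  | add f g hf hg => simp [weightedReflect_add, hf, hg]
  | monomial i j r => simp [weightedReflect_monomial_monomial]

theorem evalAt_weightedReflect_eq_sum (φ : R →+* A) (N a b : ℕ) (u v : A) (f : R[X][Y]) :
    evalAt φ u v (weightedReflect N a b f) =
      f.sum fun j c => c.sum fun i r => φ r * u ^ (N - b * i - a * j) * v ^ j := by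
  simp only [weightedReflect, Polynomial.sum_def, map_sum, evalAt_monomial_monomial]

theorem evalAt_weightedReflect (φ : R →+* A) {N a b : ℕ} {σ u v : A} (hσ : σ ^ b * u = 1)
    {f : R[X][Y]} (hf : ∀ i j, (f.coeff j).coeff i ≠ 0 → b * i + a * j ≤ N) :
    evalAt φ σ (v * σ ^ a) (weightedReflect N a b f) = σ ^ N * evalAt φ u v f := by
  rw [evalAt_weightedReflect_eq_sum, evalAt_eq_sum]
  simp only [Polynomial.sum_def, Finset.mul_sum]
  refine Finset.sum_congr rfl fun j _ => Finset.sum_congr rfl fun i hi => ?_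
  have h := hf i j (mem_support_iff.mp hi)
  obtain ⟨k, hk⟩ := Nat.exists_eq_add_of_le h
  have h1 : N - b * i - a * j = k := by omega
  have h2 : (σ ^ b) ^ i * u ^ i = 1 := by rw [← mul_pow, hσ, one_pow]
  rw [h1, hk]
  calc _ = φ ((f.coeff j).coeff i) * σ ^ k * (v * σ ^ a) ^ j * ((σ ^ b) ^ i * u ^ i) := by
        rw [h2, mul_one]
    _ = _ := by ring

theorem natDegree_weightedReflect {a b : ℕ} {f : R[X][Y]} (hd : f.natDegree = b) :
    (weightedReflect (a * b) a b f).natDegree ≤ b := by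
  refine natDegree_le_iff_coeff_eq_zero.mpr fun j hj => ?_
  rw [coeff_weightedReflect, coeff_eq_zero_of_natDegree_lt (by omega), sum_zero_index]

theorem coeff_weightedReflect_natDegree {a b : ℕ} {f : R[X][Y]} (hf : f.Monic)
    (hd : f.natDegree = b) : (weightedReflect (a * b) a b f).coeff b = 1 := by
  have h : f.coeff b = 1 := hd ▸ hf
  rw [coeff_weightedReflect, h, ← monomial_zero_one, sum_monomial_index _ _ (by simp)]
  simp

theorem monic_weightedReflect {a b : ℕ} {f : R[X][Y]} (hf : f.Monic) (hd : f.natDegree = b) :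
    (weightedReflect (a * b) a b f).Monic :=
  monic_of_natDegree_le_of_coeff_eq_one b (natDegree_weightedReflect hd)
    (coeff_weightedReflect_natDegree hf hd)

/-- At `σ = 0` the rescaled polynomial is the part of `f` on the hypotenuse, taken at `x = 1`. -/
theorem evalAt_zero_weightedReflect (φ : R →+* A) {a b : ℕ} (t : A) {f : R[X][Y]}
    (hf : SupportedInTriangle a b f) {γ : Set (ℝ × ℝ)}
    (hγ : ∀ i j : ℕ, (f.coeff j).coeff i ≠ 0 →
      (((i : ℝ), (j : ℝ)) ∈ γ ↔ b * i + a * j = a * b)) :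
    evalAt φ 0 t (weightedReflect (a * b) a b f) = evalAt φ 1 t (restrictTo f γ) := by
  classical
  rw [evalAt_weightedReflect_eq_sum, evalAt_restrictTo]
  refine Finset.sum_congr rfl fun j _ => Finset.sum_congr rfl fun i hi => ?_
  have h := hf i j (mem_support_iff.mp hi)
  have h' := hγ i j (mem_support_iff.mp hi)
  dsimp only
  split_ifs with hm
  · rw [show a * b - b * i - a * j = 0 by have := h'.mp hm; omega]
    simp
  · rw [zero_pow (by have := mt h'.mpr hm; omega)]
    simp

end WeightedReflect

/-! ### Consequences of nondegeneracy over the residue field -/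

theorem ringHom_eq_evalAt {R A : Type*} [CommRing R] [CommRing A] (φ : R[X][Y] →+* A)
    (f : R[X][Y]) : φ f = evalAt (φ.comp (C.comp C)) (φ (C X)) (φ X) f := by
  rw [← map_evalAt, evalAt_C_X]

theorem not_forall_eq_zero_of_span_eq_top {R A : Type*} [CommRing R] [CommRing A] [Nontrivial A]
    {s : Set R} (hs : Ideal.span s = ⊤) (φ : R →+* A) : ¬ ∀ f ∈ s, φ f = 0 := by
  intro h
  have h1 : Ideal.span s ≤ RingHom.ker φ := Ideal.span_le.mpr fun f hf => h f hf
  rw [hs] at h1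
  have h2 : φ 1 = 0 := h1 (Submodule.mem_top (x := (1 : R)))
  rw [map_one] at h2
  exact one_ne_zero h2

/-- The weak Nullstellensatz in two variables. -/
theorem span_eq_top_of_no_common_zero {k : Type*} [Field k] (s : Set k[X][Y])
    (h : ∀ u v : AlgebraicClosure k, ¬ ∀ f ∈ s, evalAt (algebraMap k _) u v f = 0) :
    Ideal.span s = ⊤ := by
  by_contra hne
  obtain ⟨m, hm, hle⟩ := Ideal.exists_le_maximal _ hne
  let _ : Field (k[X][Y] ⧸ m) := Ideal.Quotient.field m
  have : Algebra.FiniteType k k[X][Y] :=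
    Algebra.FiniteType.trans (S := k[X]) inferInstance inferInstance
  have : Algebra.FiniteType k (k[X][Y] ⧸ m) :=
    Algebra.FiniteType.of_surjective (Ideal.Quotient.mkₐ k m) (Ideal.Quotient.mkₐ_surjective k m)
  have : Module.Finite k (k[X][Y] ⧸ m) := finite_of_finite_type_of_isJacobsonRing k _
  let ψ : (k[X][Y] ⧸ m) →ₐ[k] AlgebraicClosure k := IsAlgClosed.lift
  let φ : k[X][Y] →ₐ[k] AlgebraicClosure k := ψ.comp (Ideal.Quotient.mkₐ k m)
  refine h (φ (C X)) (φ X) fun f hf => ?_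
  have h1 : φ.toRingHom.comp (C.comp C) = algebraMap k (AlgebraicClosure k) :=
    φ.comp_algebraMap
  have h2 := ringHom_eq_evalAt φ.toRingHom f
  rw [h1] at h2
  refine Eq.trans h2.symm ?_
  change ψ (Ideal.Quotient.mk m f) = 0
  rw [Ideal.Quotient.eq_zero_iff_mem.mpr (hle (Ideal.subset_span hf)), map_zero]

theorem le_of_mem_triangle {a b : ℕ} {α β c : ℝ} (h0 : 0 ≤ c) (h1 : α * a ≤ c) (h2 : β * b ≤ c)
    {P : ℝ × ℝ} (hP : P ∈ triangle a b) : α * P.1 + β * P.2 ≤ c := by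
  have hconv : Convex ℝ {P : ℝ × ℝ | α * P.1 + β * P.2 ≤ c} :=
    convex_halfSpace_le (f := fun P : ℝ × ℝ => α * P.1 + β * P.2)
      ⟨fun _ _ => by simp; ring, fun _ _ => by simp; ring⟩ c
  refine convexHull_min ?_ hconv hP
  rintro P (rfl | rfl | rfl) <;> simpa

section Nondegenerate

variable {k : Type*} [Field k] {Q : k[X][Y]} {a b : ℕ}

/-- Nondegeneracy on the face of the triangle where `α * x + β * y` attains its maximum `c`. -/
theorem IsNondegenerate.no_singular_point (hnd : IsNondegenerate Q (triangle a b)) {α β c : ℝ}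
    (h0 : 0 ≤ c) (h1 : α * a ≤ c) (h2 : β * b ≤ c) (hc : 0 = c ∨ α * a = c ∨ β * b = c)
    {g : k[X][Y]} (hg : ∀ i j : ℕ, α * i + β * j = c → (g.coeff j).coeff i = (Q.coeff j).coeff i)
    (hg' : ∀ i j : ℕ, α * i + β * j ≠ c → (g.coeff j).coeff i = 0)
    {u v : AlgebraicClosure k} (hu : u ≠ 0) (hv : v ≠ 0) (h : evalAt (algebraMap k _) u v g = 0)
    (hx : evalAt (algebraMap k _) u v (partialX g) = 0)
    (hy : evalAt (algebraMap k _) u v (partialY g) = 0) : False := by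
  classical
  let γ : Set (ℝ × ℝ) := {P ∈ triangle a b | α * P.1 + β * P.2 = c}
  have hv0 : ((0 : ℝ), (0 : ℝ)) ∈ triangle a b := subset_convexHull _ _ (by simp)
  have hv1 : ((a : ℝ), (0 : ℝ)) ∈ triangle a b := subset_convexHull _ _ (by simp)
  have hv2 : ((0 : ℝ), (b : ℝ)) ∈ triangle a b := subset_convexHull _ _ (by simp)
  have hne : γ.Nonempty := by
    rcases hc with hc | hc | hc
    · exact ⟨_, hv0, by simpa using hc⟩
    · exact ⟨_, hv1, by simpa using hc⟩
    · exact ⟨_, hv2, by simpa using hc⟩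
  have hexp : IsExposed ℝ (triangle a b) γ := by
    intro _
    refine ⟨α • ContinuousLinearMap.fst ℝ ℝ ℝ + β • ContinuousLinearMap.snd ℝ ℝ ℝ, ?_⟩
    obtain ⟨P₀, hP₀, hP₀c⟩ := hne
    ext P
    simp only [γ, Set.mem_ofPred_eq, add_apply, FunLike.coe_smul, Pi.smul_apply,
      ContinuousLinearMap.coe_fst', ContinuousLinearMap.coe_snd', smul_eq_mul]
    constructor
    · rintro ⟨hP, hPc⟩
      exact ⟨hP, fun P' hP' => (le_of_mem_triangle h0 h1 h2 hP').trans hPc.ge⟩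
    · rintro ⟨hP, hmax⟩
      exact ⟨hP, le_antisymm (le_of_mem_triangle h0 h1 h2 hP) (hP₀c.ge.trans (hmax P₀ hP₀))⟩
  have hgr : restrictTo Q γ = g := by
    refine ext_coeff_coeff fun i j => ?_
    rw [coeff_coeff_restrictTo]
    by_cases hij : α * i + β * j = c
    · rw [hg i j hij]
      split_ifs with hm
      · rfl
      · by_contra hq
        exact hm ⟨hnd.1 i j (Ne.symm hq), hij⟩
    · rw [hg' i j hij, if_neg fun hm => hij hm.2]
  have := hnd.2 γ hne hexp u v hu hv
  rw [hgr, valueAt_eq_evalAt, valueAt_eq_evalAt, valueAt_eq_evalAt] at this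
  exact this ⟨h, hx, hy⟩

theorem IsNondegenerate.supportedInTriangle (hnd : IsNondegenerate Q (triangle a b)) :
    SupportedInTriangle a b Q := by
  intro i j hij
  have h := le_of_mem_triangle (α := b) (β := a) (c := a * b) (by positivity)
    (mul_comm _ _).le le_rfl (hnd.1 i j hij)
  dsimp only at h
  exact_mod_cast h

/-- Nondegeneracy at a vertex says that the corresponding coefficient does not vanish. -/
theorem IsNondegenerate.exists_coeff_ne_zero (hnd : IsNondegenerate Q (triangle a b)) {α β c : ℝ}
    (h0 : 0 ≤ c) (h1 : α * a ≤ c) (h2 : β * b ≤ c) (hc : 0 = c ∨ α * a = c ∨ β * b = c) :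
    ∃ i j : ℕ, α * i + β * j = c ∧ (Q.coeff j).coeff i ≠ 0 := by
  by_contra! h
  exact hnd.no_singular_point h0 h1 h2 hc (g := 0) (fun i j hij => by simp [h i j hij])
    (by simp) (one_ne_zero) one_ne_zero (map_zero _) (by simp [partialX]) (by simp [partialY])

theorem IsNondegenerate.coeff_zero_coeff_zero_ne_zero (hnd : IsNondegenerate Q (triangle a b)) :
    (Q.coeff 0).coeff 0 ≠ 0 := by
  obtain ⟨i, j, hij, hq⟩ := hnd.exists_coeff_ne_zero (α := -1) (β := -1) (c := 0) le_rfl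
    (by simp) (by simp) (Or.inl rfl)
  have h : (i : ℝ) + j = 0 := by linarith
  norm_cast at h
  obtain ⟨rfl, rfl⟩ : i = 0 ∧ j = 0 := by omega
  exact hq

theorem IsNondegenerate.coeff_zero_coeff_ne_zero (hnd : IsNondegenerate Q (triangle a b))
    (ha : 0 < a) (hb : 0 < b) : (Q.coeff 0).coeff a ≠ 0 := by
  have hab : (0 : ℝ) ≤ a * b := by positivity
  obtain ⟨i, j, hij, hq⟩ := hnd.exists_coeff_ne_zero (α := 2 * b) (β := a) (c := 2 * (a * b))
    (by linarith) (by linarith) (by linarith) (Or.inr (Or.inl (by ring)))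
  have h := hnd.supportedInTriangle i j hq
  norm_cast at hij
  have hj : j = 0 := by
    by_contra hj
    have : 0 < a * j := by positivity
    nlinarith
  subst hj
  have : i = a := by
    have : b * i = b * a := by nlinarith
    exact Nat.eq_of_mul_eq_mul_left hb this
  rwa [this] at hq

theorem IsNondegenerate.coeff_coeff_zero_ne_zero (hnd : IsNondegenerate Q (triangle a b))
    (ha : 0 < a) (hb : 0 < b) : (Q.coeff b).coeff 0 ≠ 0 := by
  have hab : (0 : ℝ) ≤ a * b := by positivity
  obtain ⟨i, j, hij, hq⟩ := hnd.exists_coeff_ne_zero (α := b) (β := 2 * a) (c := 2 * (a * b))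
    (by linarith) (by linarith) (by linarith) (Or.inr (Or.inr (by ring)))
  have h := hnd.supportedInTriangle i j hq
  norm_cast at hij
  have hi : i = 0 := by
    by_contra hi
    have : 0 < b * i := by positivity
    nlinarith
  subst hi
  have : j = b := by
    have : a * j = a * b := by nlinarith
    exact Nat.eq_of_mul_eq_mul_left ha this
  rwa [this] at hq

theorem IsNondegenerate.natDegree_eq (hnd : IsNondegenerate Q (triangle a b))
    (ha : 0 < a) (hb : 0 < b) : Q.natDegree = b := by
  refine natDegree_eq_of_le_of_coeff_ne_zero (natDegree_le_iff_coeff_eq_zero.mpr fun j hj => ?_)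
    fun h => hnd.coeff_coeff_zero_ne_zero ha hb (by rw [h, coeff_zero])
  ext i
  by_contra h
  have := hnd.supportedInTriangle i j h
  have : a * b < a * j := Nat.mul_lt_mul_of_pos_left hj ha
  omega

theorem evalAt_right_zero {R A : Type*} [CommRing R] [CommRing A] (φ : R →+* A) (u : A)
    (f : R[X][Y]) : evalAt φ u 0 f = (f.coeff 0).eval₂ φ u := by
  simp [evalAt, eval₂_at_zero]

theorem evalAt_map_constantCoeff {R A : Type*} [CommRing R] [CommRing A] (φ : R →+* A) (u v : A)
    (f : R[X][Y]) : evalAt φ u v (f.map (C.comp constantCoeff)) = evalAt φ 0 v f := by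
  simp only [evalAt, coe_eval₂RingHom, eval₂_map]
  congr 1
  ext <;> simp

/-- The affine curve `Q = 0` is smooth. -/
theorem IsNondegenerate.span_eq_top (hnd : IsNondegenerate Q (triangle a b)) :
    Ideal.span {Q, partialX Q, partialY Q} = ⊤ := by
  refine span_eq_top_of_no_common_zero _ fun u v h => ?_
  simp only [Set.mem_insert_iff, Set.mem_singleton_iff, forall_eq_or_imp, forall_eq] at h
  obtain ⟨h, hx, hy⟩ := h
  by_cases hu : u = 0
  · by_cases hv : v = 0
    · subst hu hv
      rw [evalAt_right_zero, eval₂_at_zero, map_eq_zero] at h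
      exact hnd.coeff_zero_coeff_zero_ne_zero h
    · -- the part of `Q` on the edge `x = 0` does not involve `x`, and is singular at `(1, v)`
      subst hu
      refine hnd.no_singular_point (α := -1) (β := 0) (c := 0) le_rfl (by simp) (by simp)
        (Or.inl rfl) (g := Q.map (C.comp constantCoeff)) ?_ ?_ one_ne_zero hv
        (by rwa [evalAt_map_constantCoeff]) ?_ ?_
      · intro i j hij
        obtain rfl : i = 0 := by simpa using hij
        simp
      · intro i j hij
        have hi : i ≠ 0 := by rintro rfl; simp at hij
        simp [coeff_C, hi]
      · rw [show partialX (Q.map (C.comp constantCoeff)) = 0 from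
          ext_coeff_coeff fun i j => by simp [coeff_partialX], map_zero]
      · rwa [partialY, derivative_map, evalAt_map_constantCoeff]
  · by_cases hv : v = 0
    · -- the part of `Q` on the edge `y = 0` does not involve `y`, and is singular at `(u, 1)`
      subst hv
      refine hnd.no_singular_point (α := 0) (β := -1) (c := 0) le_rfl (by simp) (by simp)
        (Or.inl rfl) (g := C (Q.coeff 0)) ?_ ?_ hu one_ne_zero
        (by rwa [evalAt_C, ← evalAt_right_zero]) ?_ (by simp [partialY])
      · intro i j hij
        obtain rfl : j = 0 := by simpa using hij
        simp
      · intro i j hij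
        have hj : j ≠ 0 := by rintro rfl; simp at hij
        simp [coeff_C, hj]
      · have h1 : partialX (C (Q.coeff 0)) = C (derivative (Q.coeff 0)) := by
          refine ext_coeff_coeff fun i j => ?_
          rw [coeff_partialX, coeff_C, coeff_C]
          split_ifs <;> simp
        rwa [h1, evalAt_C, ← coeff_partialX, ← evalAt_right_zero]
    · exact hnd.no_singular_point (α := 0) (β := 0) (c := 0) le_rfl (by simp) (by simp)
        (Or.inl rfl) (g := Q) (by simp) (by simp) hu hv h hx hy

/-- The hypotenuse of the triangle, or rather the line that it spans. -/
def hypotenuse (a b : ℕ) : Set (ℝ × ℝ) := {P | b * P.1 + a * P.2 = a * b}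

theorem mem_hypotenuse_iff {i j : ℕ} :
    ((i : ℝ), (j : ℝ)) ∈ hypotenuse a b ↔ b * i + a * j = a * b := by
  simp only [hypotenuse, Set.mem_ofPred_eq]
  norm_cast

theorem coeff_zero_restrictTo_hypotenuse {R : Type*} [CommRing R] (hb : 0 < b) (f : R[X][Y]) :
    (restrictTo f (hypotenuse a b)).coeff 0 = monomial a ((f.coeff 0).coeff a) := by
  classical
  ext i
  rw [coeff_coeff_restrictTo, coeff_monomial, mem_hypotenuse_iff]
  by_cases hi : a = i
  · subst hi
    simp [mul_comm]
  · rw [if_neg hi, if_neg]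
    intro h
    refine hi (Nat.eq_of_mul_eq_mul_left hb ?_)
    linarith

/-- The curve in the torus defined by the part of `Q` on the hypotenuse is smooth along `x = 1`. -/
theorem IsNondegenerate.span_edge_eq_top (hnd : IsNondegenerate Q (triangle a b))
    (ha : 0 < a) (hb : 0 < b) :
    Ideal.span {restrictTo Q (hypotenuse a b), partialX (restrictTo Q (hypotenuse a b)),
      partialY (restrictTo Q (hypotenuse a b)), C X - 1} = ⊤ := by
  refine span_eq_top_of_no_common_zero _ fun u v h => ?_
  simp only [Set.mem_insert_iff, Set.mem_singleton_iff, forall_eq_or_imp, forall_eq] at h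
  obtain ⟨h, hx, hy, h1⟩ := h
  obtain rfl : u = 1 := by simpa [sub_eq_zero] using h1
  have hv : v ≠ 0 := by
    rintro rfl
    rw [evalAt_right_zero, coeff_zero_restrictTo_hypotenuse hb, eval₂_monomial,
      one_pow, mul_one, map_eq_zero] at h
    exact hnd.coeff_zero_coeff_ne_zero ha hb h
  refine hnd.no_singular_point (α := b) (β := a) (c := a * b) (by positivity)
    (mul_comm _ _).le le_rfl (Or.inr (Or.inr rfl)) (fun i j hij => ?_) (fun i j hij => ?_)
    one_ne_zero hv h hx hy
  · rw [coeff_coeff_restrictTo, if_pos (mem_hypotenuse_iff.mpr (by exact_mod_cast hij))]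
  · rw [coeff_coeff_restrictTo, if_neg (mt mem_hypotenuse_iff.mp (by exact_mod_cast hij))]

end Nondegenerate

/-! ### The part of a polynomial on the hypotenuse -/

section Restrict

variable {R S : Type*} [CommRing R] [CommRing S] {a b : ℕ}

theorem restrictTo_map (ρ : R →+* S) (f : R[X][Y]) (γ : Set (ℝ × ℝ)) :
    restrictTo (f.map (mapRingHom ρ)) γ = (restrictTo f γ).map (mapRingHom ρ) := by
  classical
  refine ext_coeff_coeff fun i j => ?_
  simp only [coeff_coeff_restrictTo, coeff_map, coe_mapRingHom]
  split_ifs <;> simp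

theorem coeff_coeff_C_X_mul_partialX (f : R[X][Y]) (i j : ℕ) :
    ((C X * partialX f).coeff j).coeff i = (f.coeff j).coeff i * i := by
  rw [coeff_C_mul]
  cases i with
  | zero => simp
  | succ i => rw [coeff_X_mul, coeff_coeff_partialX]; push_cast; ring

theorem coeff_coeff_X_mul_partialY (f : R[X][Y]) (i j : ℕ) :
    ((X * partialY f).coeff j).coeff i = (f.coeff j).coeff i * j := by
  cases j with
  | zero => simp
  | succ j => rw [coeff_X_mul, coeff_coeff_partialY]; push_cast; ring

theorem restrictTo_C_X_mul_partialX (f : R[X][Y]) (γ : Set (ℝ × ℝ)) :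
    restrictTo (C X * partialX f) γ = C X * partialX (restrictTo f γ) := by
  classical
  refine ext_coeff_coeff fun i j => ?_
  simp only [coeff_coeff_restrictTo, coeff_coeff_C_X_mul_partialX, ite_mul, zero_mul]

theorem restrictTo_X_mul_partialY (f : R[X][Y]) (γ : Set (ℝ × ℝ)) :
    restrictTo (X * partialY f) γ = X * partialY (restrictTo f γ) := by
  classical
  refine ext_coeff_coeff fun i j => ?_
  simp only [coeff_coeff_restrictTo, coeff_coeff_X_mul_partialY, ite_mul, zero_mul]

theorem SupportedInTriangle.C_X_mul_partialX {f : R[X][Y]} (hf : SupportedInTriangle a b f) :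
    SupportedInTriangle a b (C X * partialX f) := fun i j hij =>
  hf i j fun h => hij (by rw [coeff_coeff_C_X_mul_partialX, h, zero_mul])

theorem SupportedInTriangle.X_mul_partialY {f : R[X][Y]} (hf : SupportedInTriangle a b f) :
    SupportedInTriangle a b (X * partialY f) := fun i j hij =>
  hf i j fun h => hij (by rw [coeff_coeff_X_mul_partialY, h, zero_mul])

theorem SupportedInTriangle.map {f : R[X][Y]} (hf : SupportedInTriangle a b f) (ρ : R →+* S) :
    SupportedInTriangle a b (f.map (mapRingHom ρ)) := fun i j hij =>
  hf i j fun h => hij (by simp [h])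

/-- Euler's identity for the part of `f` on the hypotenuse, which is weighted homogeneous. -/
theorem euler_identity_hypotenuse (f : R[X][Y]) :
    (b : R[X][Y]) * (C X * partialX (restrictTo f (hypotenuse a b))) +
      (a : R[X][Y]) * (X * partialY (restrictTo f (hypotenuse a b))) =
      ((a * b : ℕ) : R[X][Y]) * restrictTo f (hypotenuse a b) := by
  classical
  refine ext_coeff_coeff fun i j => ?_
  rw [← restrictTo_C_X_mul_partialX, ← restrictTo_X_mul_partialY]
  simp only [← nsmul_eq_mul, coeff_add, coeff_smul, coeff_coeff_C_X_mul_partialX,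
    coeff_coeff_X_mul_partialY, coeff_coeff_restrictTo, mem_hypotenuse_iff]
  simp only [nsmul_eq_mul]
  split_ifs with h
  · rw [← h]
    push_cast
    ring
  · ring

theorem evalAt_zero_weightedReflect_eq {A : Type*} [CommRing A] (φ : R →+* A) (t : A)
    {f : R[X][Y]} (hf : SupportedInTriangle a b f) :
    evalAt φ 0 t (weightedReflect (a * b) a b f) =
      evalAt φ 1 t (restrictTo f (hypotenuse a b)) :=
  evalAt_zero_weightedReflect φ t hf fun _ _ _ => mem_hypotenuse_iff

theorem map_constantCoeff_weightedReflect {f : R[X][Y]} (hf : SupportedInTriangle a b f) :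
    (weightedReflect (a * b) a b f).map constantCoeff =
      (restrictTo f (hypotenuse a b)).map (evalRingHom 1) := by
  have h := evalAt_zero_weightedReflect_eq C X hf
  have h0 : (eval₂RingHom C 0 : R[X] →+* R[X]) = C.comp constantCoeff := by ext <;> simp
  have h1 : (eval₂RingHom C 1 : R[X] →+* R[X]) = C.comp (evalRingHom 1) := by ext <;> simp
  simpa only [evalAt, h0, h1, coe_eval₂RingHom, ← eval₂_map, eval₂_C_X] using h

end Restrict

/-! ### Specialization of singular points -/

section Specialization

variable {O F E : Type*} [CommRing O] [Field F] [Field E] {ρ : O →+* F}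

open IsLocalRing

/-- A homomorphism from a local ring `O` to a field `E` lands in a valuation ring of `E` whose
residue field extends the residue field `F` of `O`. -/
theorem exists_valuationSubring_specialization [IsLocalRing O] (hρ : Function.Surjective ρ)
    (ι : O →+* E) :
    ∃ (V : ValuationSubring E) (ι' : O →+* V) (j : F →+* ResidueField V),
      V.subtype.comp ι' = ι ∧ (residue V).comp ι' = j.comp ρ := by
  obtain ⟨V, h, hloc⟩ := IsLocalRing.exists_factor_valuationRing ι
  let ι' : O →+* V := ι.codRestrict V.toSubring h
  have hloc' : IsLocalHom ι' := hloc
  have hker : RingHom.ker ρ ≤ RingHom.ker ((residue V).comp ι') := by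
    intro x hx
    have hx' : ¬ IsUnit x := fun hu => (hu.map ρ).ne_zero hx
    have : ¬ IsUnit (ι' x) := fun hu => hx' (isUnit_of_map_unit ι' x hu)
    rw [RingHom.mem_ker, RingHom.comp_apply, residue_eq_zero_iff, mem_maximalIdeal]
    exact this
  refine ⟨V, ι', ρ.liftOfSurjective hρ ⟨_, hker⟩, ?_, ?_⟩
  · ext; rfl
  · ext x
    exact (RingHom.liftOfRightInverse_comp_apply ρ _
      (Function.rightInverse_surjInv hρ) ⟨_, hker⟩ x).symm

variable {V : ValuationSubring E} {ι' : O →+* V}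

/-- Valuation rings are integrally closed: on a curve that is monic in `y`, a point with integral
abscissa has integral ordinate. -/
theorem mem_valuationSubring_of_monic {G : O[X][Y]} (hG : G.Monic) (s : V) {t : E}
    (h : evalAt (V.subtype.comp ι') (s : E) t G = 0) : t ∈ V := by
  have hint : IsIntegral V t := by
    refine ⟨G.map (eval₂RingHom ι' s), hG.map _, ?_⟩
    rw [eval₂_map]
    rw [← h, evalAt, coe_eval₂RingHom]
    congr 1
    ext <;> simp
  obtain ⟨y, rfl⟩ := (IsIntegrallyClosed.isIntegral_iff (R := V) (K := E)).mp hint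
  exact y.2

theorem evalAt_residue_eq_zero {j : F →+* ResidueField V} (hj : (residue V).comp ι' = j.comp ρ)
    {G : O[X][Y]} {s t : V} (h : evalAt (V.subtype.comp ι') (s : E) (t : E) G = 0) :
    evalAt j (residue V s) (residue V t) (G.map (mapRingHom ρ)) = 0 := by
  have h1 : evalAt ι' s t G = 0 := by
    have := map_evalAt V.subtype ι' s t G
    exact Subtype.val_injective (this.trans h)
  rw [evalAt_map, ← hj, ← map_evalAt, h1, map_zero]

variable {a b : ℕ} {f : O[X][Y]}

/-- A point of the curve `f = 0` with nonintegral abscissa specializes to a point of the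
hypotenuse: in the coordinates `σ = x ^ (-1 / b)`, `t = y * σ ^ a` it is integral, and `σ`
reduces to `0`. -/
theorem exists_specialization_on_hypotenuse [IsAlgClosed E] (hb : 0 < b) (hf : f.Monic)
    (hd : f.natDegree = b) (hs : SupportedInTriangle a b f) {j : F →+* ResidueField V}
    (hj : (residue V).comp ι' = j.comp ρ) {u v : E} (hu : u ∉ V)
    (h : evalAt (V.subtype.comp ι') u v f = 0) :
    ∃ t : ResidueField V, ∀ P : O[X][Y], SupportedInTriangle a b P →
      evalAt (V.subtype.comp ι') u v P = 0 →
      evalAt j 1 t (restrictTo (P.map (mapRingHom ρ)) (hypotenuse a b)) = 0 := by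
  have hu0 : u ≠ 0 := by rintro rfl; exact hu V.zero_mem
  have hinv : u⁻¹ ∈ V := (V.mem_or_inv_mem u).resolve_left hu
  obtain ⟨σ, hσ⟩ := IsAlgClosed.exists_pow_nat_eq u⁻¹ hb
  have hσu : σ ^ b * u = 1 := by rw [hσ, inv_mul_cancel₀ hu0]
  have hσV : σ ∈ V := by
    have hint : IsIntegral V σ := by
      refine IsIntegral.of_pow hb ?_
      rw [hσ]
      exact isIntegral_algebraMap (x := (⟨u⁻¹, hinv⟩ : V))
    obtain ⟨y, rfl⟩ := (IsIntegrallyClosed.isIntegral_iff (R := V) (K := E)).mp hint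
    exact y.2
  have hP : ∀ P : O[X][Y], SupportedInTriangle a b P → evalAt (V.subtype.comp ι') u v P = 0 →
      evalAt (V.subtype.comp ι') σ (v * σ ^ a) (weightedReflect (a * b) a b P) = 0 :=
    fun P hP hP0 => by rw [evalAt_weightedReflect _ hσu hP, hP0, mul_zero]
  have htV : v * σ ^ a ∈ V :=
    mem_valuationSubring_of_monic (monic_weightedReflect hf hd) ⟨σ, hσV⟩ (hP f hs h)
  have hres : residue V ⟨σ, hσV⟩ = 0 := by
    -- if `σ` were a unit, then so would be `u = σ ^ (-b)`
    rw [residue_eq_zero_iff, mem_maximalIdeal]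
    intro hunit
    obtain ⟨τ, hτ⟩ := hunit.exists_right_inv
    have hτ' : σ * (τ : E) = 1 := congrArg Subtype.val hτ
    have : u = (τ : E) ^ b := by
      calc u = (σ * (τ : E)) ^ b * u := by rw [hτ', one_pow, one_mul]
        _ = (σ ^ b * u) * (τ : E) ^ b := by ring
        _ = _ := by rw [hσu, one_mul]
    exact hu (this ▸ V.toSubring.pow_mem τ.2 b)
  refine ⟨residue V ⟨v * σ ^ a, htV⟩, fun P hPs hP0 => ?_⟩
  have h1 := evalAt_residue_eq_zero hj (s := ⟨σ, hσV⟩) (t := ⟨v * σ ^ a, htV⟩) (hP P hPs hP0)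
  rwa [hres, ← weightedReflect_map, evalAt_zero_weightedReflect_eq _ _ (hPs.map ρ)] at h1

/-- Smoothness of the special fibre, including its points at infinity, implies smoothness of the
generic fibre: a singular point of the latter would specialize to one of the former. -/
theorem span_eq_top_of_isNondegenerate_map [IsLocalRing O] {K : Type*} [Field K] (φ : O →+* K)
    (hρ : Function.Surjective ρ) (ha : 0 < a) (hb : 0 < b) (hf : f.Monic)
    (hs : SupportedInTriangle a b f)
    (hnd : IsNondegenerate (f.map (mapRingHom ρ)) (triangle a b)) :
    Ideal.span {f.map (mapRingHom φ), partialX (f.map (mapRingHom φ)),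
      partialY (f.map (mapRingHom φ))} = ⊤ := by
  have hd : f.natDegree = b := by rw [← hnd.natDegree_eq ha hb, hf.natDegree_map]
  refine span_eq_top_of_no_common_zero _ fun u v h => ?_
  simp only [Set.mem_insert_iff, Set.mem_singleton_iff, forall_eq_or_imp, forall_eq, partialX_map,
    partialY_map, evalAt_map] at h
  obtain ⟨V, ι', j, hι, hj⟩ := exists_valuationSubring_specialization hρ
    ((algebraMap K (AlgebraicClosure K)).comp φ)
  rw [← hι] at h
  obtain ⟨h, hx, hy⟩ := h
  by_cases hu : u ∈ V
  · have hv : v ∈ V := mem_valuationSubring_of_monic hf ⟨u, hu⟩ h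
    refine not_forall_eq_zero_of_span_eq_top hnd.span_eq_top
      (evalAt j (residue V ⟨u, hu⟩) (residue V ⟨v, hv⟩)) ?_
    simp only [Set.mem_insert_iff, Set.mem_singleton_iff, forall_eq_or_imp, forall_eq,
      partialX_map, partialY_map]
    exact ⟨evalAt_residue_eq_zero hj h, evalAt_residue_eq_zero hj hx,
      evalAt_residue_eq_zero hj hy⟩
  · obtain ⟨t, ht⟩ := exists_specialization_on_hypotenuse hb hf hd hs hj hu h
    have h0 := ht f hs h
    have hx0 := ht _ hs.C_X_mul_partialX (by rw [map_mul, hx, mul_zero])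
    have hy0 := ht _ hs.X_mul_partialY (by rw [map_mul, hy, mul_zero])
    rw [restrictTo_map, restrictTo_C_X_mul_partialX] at hx0
    rw [restrictTo_map, restrictTo_X_mul_partialY] at hy0
    have ht0 : t ≠ 0 := by
      rintro rfl
      rw [evalAt_right_zero, coeff_zero_restrictTo_hypotenuse hb, eval₂_monomial, one_pow, mul_one,
        map_eq_zero] at h0
      exact hnd.coeff_zero_coeff_ne_zero ha hb h0
    refine not_forall_eq_zero_of_span_eq_top (hnd.span_edge_eq_top ha hb) (evalAt j 1 t) ?_
    simp only [Set.mem_insert_iff, Set.mem_singleton_iff, forall_eq_or_imp, forall_eq]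
    refine ⟨h0, ?_, ?_, by simp⟩
    · simpa [restrictTo_map, partialX_map] using hx0
    · simpa [restrictTo_map, partialY_map, ht0] using hy0

/-- The edge polynomial of a lift is separable: a double root would specialize to a singular
point on the hypotenuse. Characteristic zero is needed for the derivative with respect to `x`,
which Euler's identity only controls up to the factor `b`. -/
theorem separable_edge_of_isNondegenerate_map [IsLocalRing O] {K : Type*} [Field K]
    [CharZero K] (φ : O →+* K)
    (hρ : Function.Surjective ρ) (ha : 0 < a) (hb : 0 < b) (hf : f.Monic)
    (hs : SupportedInTriangle a b f)
    (hnd : IsNondegenerate (f.map (mapRingHom ρ)) (triangle a b)) :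
    ((weightedReflect (a * b) a b (f.map (mapRingHom φ))).map constantCoeff).Separable := by
  have hd : f.natDegree = b := by rw [← hnd.natDegree_eq ha hb, hf.natDegree_map]
  rw [map_constantCoeff_weightedReflect (hs.map φ), restrictTo_map, Polynomial.Separable,
    isCoprime_iff_aeval_ne_zero_of_isAlgClosed K (AlgebraicClosure K)]
  intro t
  by_contra! h
  obtain ⟨h, hy⟩ := h
  obtain ⟨V, ι', j, hι, hj⟩ := exists_valuationSubring_specialization hρ
    ((algebraMap K (AlgebraicClosure K)).comp φ)
  have hev : ∀ P : K[X][Y], aeval t (P.map (evalRingHom 1)) =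
      evalAt (algebraMap K (AlgebraicClosure K)) 1 t P := fun P => by
    rw [aeval_def, eval₂_map, evalAt, coe_eval₂RingHom]
    congr 1
    ext <;> simp
  rw [derivative_map, hev] at hy
  rw [hev] at h
  change evalAt _ 1 t (partialY _) = 0 at hy
  rw [partialY_map] at hy
  rw [evalAt_map, ← hι] at h hy
  have hx : evalAt (V.subtype.comp ι') 1 t (partialX (restrictTo f (hypotenuse a b))) = 0 := by
    have h1 := congrArg (evalAt (V.subtype.comp ι') 1 t) (euler_identity_hypotenuse (a := a)
      (b := b) f)
    simp only [map_add, map_mul, h, hy, mul_zero, add_zero, map_natCast, evalAt_C, eval₂_X,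
      one_mul, mul_eq_zero, Nat.cast_eq_zero] at h1
    exact h1.resolve_left hb.ne'
  have htV : t ∈ V := by
    refine mem_valuationSubring_of_monic (ι' := ι') (monic_weightedReflect (a := a) hf hd) 0 ?_
    rw [← h]
    exact evalAt_zero_weightedReflect_eq _ _ hs
  refine not_forall_eq_zero_of_span_eq_top (hnd.span_edge_eq_top ha hb)
    (evalAt j 1 (residue V ⟨t, htV⟩)) ?_
  simp only [Set.mem_insert_iff, Set.mem_singleton_iff, forall_eq_or_imp, forall_eq]
  rw [restrictTo_map, partialX_map, partialY_map, ← map_one (residue V)]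
  exact ⟨evalAt_residue_eq_zero hj h, evalAt_residue_eq_zero hj hx, evalAt_residue_eq_zero hj hy,
    by simp⟩

end Specialization

/-! ### Smooth affine curves are normal -/

section Conductor

/-- If `G` is monic with root `x`, then `G'(x)` multiplies integral elements of the field generated
by `x` into the ring generated by `x`: by Euler's formula, the ring generated by `x` is the dual
of its multiple by the inverse different `1 / G'(x)`, when `G` is the minimal polynomial. -/
theorem aeval_derivative_mul_mem_adjoin (A k : Type*) {L : Type*} [CommRing A] [IsDomain A]
    [IsIntegrallyClosed A] [Field k] [CharZero k] [Field L] [Algebra A k] [IsFractionRing A k]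
    [Algebra k L] [Algebra A L] [IsScalarTower A k L] {x : L} (hx : Algebra.adjoin k {x} = ⊤)
    {G : A[X]} (hG : G.Monic) (h : aeval x G = 0) {z : L} (hz : IsIntegral A z) :
    aeval x (derivative G) * z ∈ Algebra.adjoin A {x} := by
  have hAx : IsIntegral A x := ⟨G, hG, h⟩
  have hkx : IsIntegral k x := hAx.tower_top
  have : FiniteDimensional k L := by
    have h1 := hkx.fg_adjoin_singleton
    rw [hx, Algebra.top_toSubmodule] at h1
    exact ⟨h1⟩
  have : FaithfulSMul A k := (faithfulSMul_iff_algebraMap_injective A k).mpr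
    (IsFractionRing.injective A k)
  have : FaithfulSMul A L := FaithfulSMul.trans A k L
  have hzd : z ∈ (Algebra.traceForm k L).dualSubmodule
      (Subalgebra.toSubmodule (Algebra.adjoin A {x})) := by
    rw [LinearMap.BilinForm.mem_dualSubmodule]
    intro y hy
    have hy' : IsIntegral A y :=
      (Algebra.adjoin_le (S := integralClosure A L) (Set.singleton_subset_iff.mpr hAx)) hy
    have := Algebra.isIntegral_trace (L := k) (hz.mul hy')
    obtain ⟨c, hc⟩ := IsIntegrallyClosed.isIntegral_iff.mp this
    rw [Algebra.traceForm_apply, ← hc]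
    exact Submodule.mem_one.mpr ⟨c, rfl⟩
  rw [traceForm_dualSubmodule_adjoin A k hx hAx] at hzd
  obtain ⟨w, hw, rfl⟩ := hzd
  obtain ⟨q, rfl⟩ := minpoly.isIntegrallyClosed_dvd hAx h
  have hne : aeval x (derivative (minpoly k x)) ≠ 0 :=
    (minpoly.irreducible hkx).separable.aeval_derivative_ne_zero (minpoly.aeval k x)
  have h1 : aeval x (derivative (minpoly k x)) = aeval x (derivative (minpoly A x)) := by
    rw [minpoly.isIntegrallyClosed_eq_field_fractions' k hAx, derivative_map, aeval_map_algebraMap]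
  rw [h1] at hne
  have h2 : aeval x (derivative (minpoly A x * q)) =
      aeval x (derivative (minpoly A x)) * aeval x q := by
    rw [derivative_mul, map_add, map_mul, map_mul, minpoly.aeval, zero_mul, add_zero]
  have h3 : aeval x (derivative (minpoly A x * q)) *
      ((aeval x (derivative (minpoly k x)))⁻¹ * w) = aeval x q * w := by
    rw [h2, h1]
    field_simp
  change _ * ((aeval x (derivative (minpoly k x)))⁻¹ * w) ∈ _
  rw [h3]
  exact mul_mem (aeval_mem_adjoin_singleton A x) hw

theorem isIntegrallyClosed_adjoin_singleton (K : Type*) {L : Type*} [Field K] [Field L]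
    [Algebra K L] (u : L) : IsIntegrallyClosed (Algebra.adjoin K {u}) := by
  have hs : Function.Surjective ((aeval u : K[X] →ₐ[K] L).codRestrict (Algebra.adjoin K {u})
      fun p => aeval_mem_adjoin_singleton K u) := by
    rintro ⟨w, hw⟩
    rw [Algebra.adjoin_singleton_eq_range_aeval] at hw
    obtain ⟨p, rfl⟩ := hw
    exact ⟨p, rfl⟩
  have : IsPrincipalIdealRing (Algebra.adjoin K {u}) :=
    IsPrincipalIdealRing.of_surjective _ hs
  infer_instance

variable {K L : Type*} [Field K] [Field L] [Algebra K L] {u v : L}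

theorem evalAt_mem_adjoin (f : K[X][Y]) :
    evalAt (algebraMap K L) u v f ∈ Algebra.adjoin K {u, v} := by
  have hu : u ∈ Algebra.adjoin K {u, v} := Algebra.subset_adjoin (by simp)
  have hv : v ∈ Algebra.adjoin K {u, v} := Algebra.subset_adjoin (by simp)
  rw [evalAt_eq_sum]
  exact sum_mem fun j _ => sum_mem fun i _ => mul_mem (mul_mem (algebraMap_mem _ _)
    (pow_mem hu _)) (pow_mem hv _)

theorem aeval_map_adjoin_singleton (g : K[X][Y]) :
    aeval v (g.map (eval₂RingHom (algebraMap K (Algebra.adjoin K {u}))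
      ⟨u, Algebra.self_mem_adjoin_singleton K u⟩)) = evalAt (algebraMap K L) u v g := by
  rw [aeval_def, eval₂_map, evalAt, coe_eval₂RingHom]
  congr 1
  ext
  · simp
  · simp

theorem isIntegral_adjoin_of_monic {P : K[X][Y]} (hP : P.Monic)
    (h : evalAt (algebraMap K L) u v P = 0) : IsIntegral (Algebra.adjoin K {u}) v :=
  ⟨_, hP.map _, (aeval_map_adjoin_singleton P).trans h⟩

open scoped IntermediateField.algebraAdjoinAdjoin in
/-- Integrality over `K[u]` is turned into membership in `K[u, v]` by the derivative with respect
to the second variable. -/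
theorem evalAt_derivative_mul_mem_adjoin [CharZero K]
    (hgen : IntermediateField.adjoin K {u, v} = ⊤)
    {P : K[X][Y]} (hP : P.Monic) (h : evalAt (algebraMap K L) u v P = 0) {z : L}
    (hz : IsIntegral (Algebra.adjoin K {u}) z) :
    evalAt (algebraMap K L) u v (derivative P) * z ∈ Algebra.adjoin K {u, v} := by
  have := isIntegrallyClosed_adjoin_singleton K u
  have hint := isIntegral_adjoin_of_monic hP h
  have hint' : IsIntegral (IntermediateField.adjoin K {u}) v := hint.tower_top
  have hgen' : Algebra.adjoin (IntermediateField.adjoin K {u}) {v} = ⊤ := by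
    have h1 : IntermediateField.adjoin (IntermediateField.adjoin K {u}) {v} = ⊤ := by
      rw [← IntermediateField.restrictScalars_eq_top_iff (K := K),
        IntermediateField.adjoin_simple_adjoin_simple, hgen]
    rw [← IntermediateField.adjoin_simple_toSubalgebra_of_isAlgebraic hint'.isAlgebraic, h1,
      IntermediateField.top_toSubalgebra]
  have h1 := aeval_derivative_mul_mem_adjoin (Algebra.adjoin K {u})
    (IntermediateField.adjoin K {u}) hgen' (hP.map _)
    ((aeval_map_adjoin_singleton P).trans h) hz
  rw [derivative_map, aeval_map_adjoin_singleton] at h1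
  have h2 : (Algebra.adjoin (Algebra.adjoin K {u}) {v}).restrictScalars K =
      Algebra.adjoin K {u, v} := by
    rw [← Algebra.adjoin_union_eq_adjoin_adjoin, Set.singleton_union]
  rw [← h2]
  exact h1

/-- A smooth affine plane curve whose equation is monic in both variables is normal. -/
theorem mem_adjoin_of_isIntegral [CharZero K] (hgen : IntermediateField.adjoin K {u, v} = ⊤)
    {f : K[X][Y]} (hf : f.Monic) {c : K} (hc : c ≠ 0) (hf' : (C (C c) * Bivariate.swap f).Monic)
    (h : evalAt (algebraMap K L) u v f = 0)
    (hsm : Ideal.span {f, partialX f, partialY f} = ⊤) {z : L}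
    (hu : IsIntegral (Algebra.adjoin K {u}) z) (hv : IsIntegral (Algebra.adjoin K {v}) z) :
    z ∈ Algebra.adjoin K {u, v} := by
  have hy := evalAt_derivative_mul_mem_adjoin hgen hf h hu
  have hx := evalAt_derivative_mul_mem_adjoin (by rwa [Set.pair_comm]) hf'
    (by rw [map_mul, evalAt_swap, h, mul_zero]) hv
  rw [derivative_C_mul, map_mul, Set.pair_comm, evalAt_C, eval₂_C] at hx
  have hx' : evalAt (algebraMap K L) u v (partialX f) * z ∈ Algebra.adjoin K {u, v} := by
    have h1 := (Algebra.adjoin K {u, v}).smul_mem hx c⁻¹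
    rw [partialX_eq_swap_derivative_swap, evalAt_swap]
    rwa [Algebra.smul_def, ← mul_assoc, ← mul_assoc, ← map_mul, inv_mul_cancel₀ hc, map_one,
      one_mul] at h1
  have h1 : (1 : K[X][Y]) ∈ Ideal.span {f, partialX f, partialY f} := hsm ▸ Submodule.mem_top
  obtain ⟨p, q, r, hpqr⟩ : ∃ p q r : K[X][Y], p * f + q * partialX f + r * partialY f = 1 :=
    Submodule.mem_span_triple.mp h1
  have h2 := congrArg (evalAt (algebraMap K L) u v) hpqr
  simp only [map_add, map_mul, h, mul_zero, zero_add, map_one] at h2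
  have : z = evalAt (algebraMap K L) u v q * (evalAt (algebraMap K L) u v (partialX f) * z) +
      evalAt (algebraMap K L) u v r * (evalAt (algebraMap K L) u v (partialY f) * z) := by
    linear_combination (-z) * h2
  rw [this]
  exact add_mem (mul_mem (evalAt_mem_adjoin _) hx') (mul_mem (evalAt_mem_adjoin _) hy)

end Conductor

/-! ### Normality along the divisor at infinity -/

section Reduced

variable {O B k : Type*} [CommRing O] [CommRing B] [Algebra O B] [Field k]

/-- Let `O[t] = O[X] / (F)`, with `F` monic, have a reduced fibre over `π = 0`. Then an integral
element `ζ` with `π ^ N * ζ ∈ O[t]` lies in `O[t]`: its integral equation shows that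
`π ^ N * ζ` is nilpotent modulo `π`. -/
theorem exists_aeval_eq_of_isIntegral (ρ : O →+* k) {π : O} (hπ : ρ π = 0)
    (hker : ∀ x, ρ x = 0 → π ∣ x) {F : O[X]} (hF : F.Monic) (hsq : Squarefree (F.map ρ))
    {t : B} (ht : ∀ g : O[X], aeval t g = 0 ↔ F ∣ g)
    (hreg : ∀ z : B, algebraMap O B π * z = 0 → z = 0) {ζ : B} (hζ : IsIntegral O ζ) (N : ℕ) :
    ∀ w : O[X], algebraMap O B π ^ N * ζ = aeval t w → ∃ w' : O[X], aeval t w' = ζ := by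
  induction N with
  | zero => exact fun w hw => ⟨w, by rw [← hw, pow_zero, one_mul]⟩
  | succ N ih =>
    intro w hw
    obtain ⟨p, hp, hpz⟩ := hζ
    have h1 : aeval (aeval t w) (p.scaleRoots (π ^ (N + 1))) = 0 := by
      rw [← hw, ← map_pow]
      exact scaleRoots_aeval_eq_zero hpz
    have h2 : F ∣ aeval w (p.scaleRoots (π ^ (N + 1))) := by
      rw [← ht, ← aeval_algHom_apply]
      exact h1
    have h3 : F.map ρ ∣ (w.map ρ) ^ p.natDegree := by
      have h4 : (aeval w (p.scaleRoots (π ^ (N + 1)))).map ρ = (w.map ρ) ^ p.natDegree := by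
        have h5 : (p.scaleRoots (π ^ (N + 1))).map ρ = X ^ p.natDegree := by
          rw [map_scaleRoots _ _ _ (by simp [hp.leadingCoeff]), map_pow, hπ,
            zero_pow (Nat.succ_ne_zero N), scaleRoots_zero, (hp.map ρ).leadingCoeff, one_smul,
            hp.natDegree_map]
        calc (aeval w (p.scaleRoots (π ^ (N + 1)))).map ρ
            = aeval (w.map ρ) ((p.scaleRoots (π ^ (N + 1))).map ρ) := by
              rw [aeval_def, aeval_def, eval₂_map]
              refine (hom_eval₂ _ _ (mapRingHom ρ) _).trans ?_
              congr 1
              ext; simp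
          _ = _ := by rw [h5, map_pow, aeval_X]
      rw [← h4]
      exact Polynomial.map_dvd ρ h2
    have h4 : F.map ρ ∣ w.map ρ := hsq.isRadical _ _ h3
    have h5 : (w %ₘ F).map ρ = 0 := by
      rw [map_modByMonic ρ hF]
      exact (modByMonic_eq_zero_iff_dvd (hF.map ρ)).mpr h4
    have h6 : C π ∣ w %ₘ F := C_dvd_iff_dvd_coeff _ _ |>.mpr fun i => hker _ (by
      rw [← coeff_map, h5, coeff_zero])
    obtain ⟨w₁, hw₁⟩ := h6
    refine ih w₁ (sub_eq_zero.mp (hreg _ ?_))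
    have h7 : aeval t w = algebraMap O B π * aeval t w₁ := by
      conv_lhs => rw [← modByMonic_add_div w F]
      rw [map_add, map_mul, (ht F).mpr dvd_rfl, zero_mul, add_zero, hw₁, map_mul, aeval_C]
    rw [mul_sub, ← h7, ← hw]
    ring

end Reduced

section Integrality

variable {K L : Type*} [Field K] [CommRing L] [Algebra K L]

/-- The coefficients in `K[s]` of an integral equation are lifted to polynomials in a variable. -/
theorem exists_monic_of_isIntegral_adjoin {s z : L} (hz : IsIntegral (Algebra.adjoin K {s}) z) :
    ∃ p : K[X][Y], p.Monic ∧ evalAt (algebraMap K L) s z p = 0 := by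
  obtain ⟨q, hq, hqz⟩ := hz
  let ψ : K[X] →+* Algebra.adjoin K {s} :=
    eval₂RingHom (algebraMap K _) ⟨s, Algebra.self_mem_adjoin_singleton K s⟩
  have hψ : ∀ c : K[X], (ψ c : L) = aeval s c := fun c => by
    have h : ((Algebra.adjoin K {s}).val : _ →+* L).comp ψ = (aeval s : K[X] →ₐ[K] L) := by
      ext
      · simp [ψ]
      · simp [ψ]
    exact congrArg (fun g : K[X] →+* L => g c) h
  have hl : q ∈ lifts ψ := (lifts_iff_coeff_lifts _).mpr fun n => by
    obtain ⟨w, hw⟩ := q.coeff n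
    have hw' := hw
    rw [Algebra.adjoin_singleton_eq_range_aeval] at hw'
    obtain ⟨c, rfl⟩ := hw'
    exact ⟨c, Subtype.ext (hψ c)⟩
  obtain ⟨p, rfl, -, hp⟩ := lifts_and_natDegree_eq_and_monic hl hq
  refine ⟨p, hp, ?_⟩
  rw [← hqz, eval₂_map, evalAt, coe_eval₂RingHom]
  congr 1
  refine RingHom.ext fun c => ?_
  exact (hψ c).symm

/-- A monic polynomial with integral coefficients has integral roots. -/
theorem isIntegral_of_monic_of_coeff_isIntegral {R : Type*} [CommRing R] [Algebra R L] {q : L[X]}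
    (hq : q.Monic) (hc : ∀ i, IsIntegral R (q.coeff i)) {z : L} (hz : q.eval z = 0) :
    IsIntegral R z := by
  have hl : q ∈ lifts (algebraMap (integralClosure R L) L) :=
    (lifts_iff_coeff_lifts _).mpr fun n => ⟨⟨_, hc n⟩, rfl⟩
  obtain ⟨p, rfl, -, hp⟩ := lifts_and_natDegree_eq_and_monic hl hq
  have h : IsIntegral (integralClosure R L) z := ⟨p, hp, by rwa [eval_map] at hz⟩
  exact isIntegral_trans z h

/-- An element that is integral over `K[x⁻¹]` becomes integral over every ring over which `x` is
integral, once it is multiplied by a suitable power of `x`. -/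
theorem exists_pow_mul_isIntegral {x s z : L} (hxs : s * x = 1)
    (hz : IsIntegral (Algebra.adjoin K {s}) z) :
    ∃ N : ℕ, ∀ (R : Type*) [CommRing R] [Algebra K R] [Algebra R L] [IsScalarTower K R L],
      IsIntegral R x → IsIntegral R (x ^ N * z) := by
  obtain ⟨p, hp, hpz⟩ := exists_monic_of_isIntegral_adjoin hz
  let N := p.support.sup fun k => (p.coeff k).natDegree
  have hN : ∀ k, (p.coeff k).natDegree ≤ N := fun k => by
    by_cases hk : k ∈ p.support
    · exact Finset.le_sup (f := fun k => (p.coeff k).natDegree) hk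
    · simp [notMem_support_iff.mp hk]
  refine ⟨N, fun R _ _ _ _ hx => ?_⟩
  rcases subsingleton_or_nontrivial L with hL | hL
  · rw [Subsingleton.elim (x ^ N * z) 0]; exact isIntegral_zero
  let q : L[X] := p.map (eval₂RingHom (algebraMap K L) s)
  have hq : q.Monic := hp.map _
  have hdeg : q.natDegree = p.natDegree := hp.natDegree_map _
  have hK : ∀ c : K, IsIntegral R (algebraMap K L c) := fun c => by
    rw [IsScalarTower.algebraMap_apply K R L]
    exact isIntegral_algebraMap
  have key : ∀ c : K[X], c.natDegree ≤ N → IsIntegral R (aeval s c * x ^ N) := fun c hc => by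
    rw [aeval_eq_sum_range, Finset.sum_mul]
    refine IsIntegral.sum _ fun i hi => ?_
    have hi' : i ≤ N := by simp at hi; omega
    have : c.coeff i • s ^ i * x ^ N = algebraMap K L (c.coeff i) * x ^ (N - i) := by
      rw [Algebra.smul_def]
      calc _ = algebraMap K L (c.coeff i) * (s ^ i * x ^ (i + (N - i))) := by
            rw [Nat.add_sub_cancel' hi', mul_assoc]
        _ = algebraMap K L (c.coeff i) * ((s * x) ^ i * x ^ (N - i)) := by ring
        _ = _ := by rw [hxs, one_pow, one_mul]
    rw [this]
    exact (hK _).mul (hx.pow _)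
  refine isIntegral_of_monic_of_coeff_isIntegral (q := q.scaleRoots (x ^ N))
    ((monic_scaleRoots_iff _).mpr hq) (fun k => ?_) ?_
  · rw [coeff_scaleRoots]
    rcases lt_trichotomy k q.natDegree with hk | hk | hk
    · obtain ⟨l, hl⟩ := Nat.exists_eq_add_of_lt hk
      have : q.natDegree - k = l + 1 := by omega
      rw [this, pow_succ', ← mul_assoc, coeff_map, coe_eval₂RingHom]
      exact (key _ (hN k)).mul ((hx.pow _).pow _)
    · subst hk
      rw [Nat.sub_self, pow_zero, mul_one, hq.coeff_natDegree]
      exact isIntegral_one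
    · rw [coeff_eq_zero_of_natDegree_lt hk, zero_mul]
      exact isIntegral_zero
  · rw [scaleRoots_eval_mul]
    rw [show q.eval z = 0 by rw [← hpz, eval_map, evalAt, coe_eval₂RingHom], mul_zero]

end Integrality

section Infinity

variable {K : Type*} [Field K]

/-- The function field `K(x)[y] / (f)` of the plane curve `f = 0`. -/
abbrev PlaneFunctionField (f : K[X][Y]) : Type _ :=
  AdjoinRoot (f.map (algebraMap K[X] (RatFunc K)))

namespace PlaneFunctionField

/-- The coordinate function `x`. -/
noncomputable abbrev x (f : K[X][Y]) : PlaneFunctionField f :=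
  algebraMap (RatFunc K) (PlaneFunctionField f) RatFunc.X

/-- The coordinate function `y`. -/
noncomputable abbrev y (f : K[X][Y]) : PlaneFunctionField f := AdjoinRoot.root _

variable (f : K[X][Y])

theorem algebraMap_polynomial (c : K[X]) :
    algebraMap K[X] (PlaneFunctionField f) c = c.eval₂ (algebraMap K _) (x f) := by
  have h : algebraMap K[X] (PlaneFunctionField f) =
      eval₂RingHom (algebraMap K (PlaneFunctionField f)) (x f) := by
    ext
    · simp [IsScalarTower.algebraMap_apply K[X] (RatFunc K) (PlaneFunctionField f),
        IsScalarTower.algebraMap_apply K (RatFunc K) (PlaneFunctionField f)]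
    · simp [IsScalarTower.algebraMap_apply K[X] (RatFunc K) (PlaneFunctionField f), x]
  rw [h, coe_eval₂RingHom]

theorem evalAt_eq_mk (g : K[X][Y]) :
    evalAt (algebraMap K _) (x f) (y f) g =
      AdjoinRoot.mk _ (g.map (algebraMap K[X] (RatFunc K))) := by
  rw [← AdjoinRoot.aeval_eq, aeval_map_algebraMap, aeval_def, evalAt, coe_eval₂RingHom]
  congr 1
  refine RingHom.ext fun c => ?_
  exact (algebraMap_polynomial f c).symm

variable {f}

theorem evalAt_eq_zero_iff (hf : f.Monic) (g : K[X][Y]) :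
    evalAt (algebraMap K _) (x f) (y f) g = 0 ↔ f ∣ g := by
  rw [evalAt_eq_mk, AdjoinRoot.mk_eq_zero,
    map_dvd_map _ (IsFractionRing.injective K[X] (RatFunc K)) hf]

theorem evalAt_self : evalAt (algebraMap K _) (x f) (y f) f = 0 := by
  rw [evalAt_eq_mk, AdjoinRoot.mk_self]

theorem aeval_y_eq_evalAt (g : K[X][Y]) :
    aeval (y f) g = evalAt (algebraMap K _) (x f) (y f) g := by
  rw [evalAt_eq_mk, ← AdjoinRoot.aeval_eq, aeval_map_algebraMap]

/-- Two polynomials of degree less than that of `f` with the same value in the function field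
are equal. -/
theorem eq_of_evalAt_eq (hf : f.Monic) {g h : K[X][Y]} (hg : g.degree < f.degree)
    (hh : h.degree < f.degree)
    (hgh : evalAt (algebraMap K _) (x f) (y f) g = evalAt (algebraMap K _) (x f) (y f) h) :
    g = h := by
  rw [← sub_eq_zero, ← map_sub, evalAt_eq_zero_iff hf] at hgh
  exact sub_eq_zero.mp (eq_zero_of_dvd_of_degree_lt hgh
    ((degree_sub_le g h).trans_lt (max_lt hg hh)))

theorem evalAt_modByMonic (g : K[X][Y]) :
    evalAt (algebraMap K _) (x f) (y f) (g %ₘ f) = evalAt (algebraMap K _) (x f) (y f) g := by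
  conv_rhs => rw [← modByMonic_add_div g f]
  rw [map_add, map_mul, evalAt_self, zero_mul, add_zero]

theorem x_inv_mul_x : algebraMap (RatFunc K) (PlaneFunctionField f) RatFunc.X⁻¹ * x f = 1 := by
  rw [← map_mul, inv_mul_cancel₀ RatFunc.X_ne_zero, map_one]

end PlaneFunctionField

open PlaneFunctionField

variable {a b : ℕ} {f : K[X][Y]}

/-- The substitution `x = σ ^ (-b)`, `y = σ ^ (-a) * t` maps the curve `f = 0` to a curve that is
unramified over the line at `σ = 0` if the edge polynomial is separable. -/
theorem exists_ringHom_weightedReflect (hb : 0 < b)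
    (hs : SupportedInTriangle a b f) :
    ∃ ψ : PlaneFunctionField f →ₐ[K] PlaneFunctionField (weightedReflect (a * b) a b f),
      x _ ^ b * ψ (x f) = 1 ∧ ψ (y f) * x _ ^ a = y (weightedReflect (a * b) a b f) := by
  let F := weightedReflect (a * b) a b f
  let B := PlaneFunctionField F
  have htr : Transcendental K ((RatFunc.X : RatFunc K)⁻¹ ^ b) :=
    (Transcendental.pow (mt (IsAlgebraic.inv_iff).mp RatFunc.transcendental_X) hb)
  let i : RatFunc K →ₐ[K] RatFunc K :=
    RatFunc.liftAlgHom (aeval ((RatFunc.X : RatFunc K)⁻¹ ^ b))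
      (nonZeroDivisors_le_comap_nonZeroDivisors_of_injective _
        (transcendental_iff_injective.mp htr))
  have hiX : i RatFunc.X = RatFunc.X⁻¹ ^ b := by
    have := RatFunc.liftAlgHom_apply_div (aeval ((RatFunc.X : RatFunc K)⁻¹ ^ b) : K[X] →ₐ[K] _)
      (nonZeroDivisors_le_comap_nonZeroDivisors_of_injective _
        (transcendental_iff_injective.mp htr)) X 1
    rw [map_one, div_one, map_one, div_one, aeval_X, RatFunc.algebraMap_X] at this
    exact this
  let j : RatFunc K →ₐ[K] B := (IsScalarTower.toAlgHom K (RatFunc K) B).comp i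
  let v : B := y F * algebraMap (RatFunc K) B RatFunc.X⁻¹ ^ a
  have hju : x F ^ b * j RatFunc.X = 1 := by
    change x F ^ b * algebraMap (RatFunc K) B (i RatFunc.X) = 1
    rw [hiX, map_pow, ← mul_pow, mul_comm, x_inv_mul_x, one_pow]
  have hv : v * x F ^ a = y F := by
    rw [mul_assoc, ← mul_pow, x_inv_mul_x, one_pow, mul_one]
  have hroot : (f.map (algebraMap K[X] (RatFunc K))).eval₂ j v = 0 := by
    have h1 : (f.map (algebraMap K[X] (RatFunc K))).eval₂ (j : RatFunc K →+* B) v =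
        evalAt (algebraMap K B) (j RatFunc.X) v f := by
      rw [eval₂_map, evalAt, coe_eval₂RingHom]
      congr 1
      ext c
      · exact (congrArg j (RatFunc.algebraMap_C c)).trans (j.commutes c) |>.trans (by simp)
      · simp
    have h2 := evalAt_weightedReflect (algebraMap K B) (v := v) hju hs
    rw [hv, evalAt_self] at h2
    have h3 : IsUnit (x F ^ (a * b)) := (IsUnit.of_mul_eq_one_right _ x_inv_mul_x).pow _
    exact h1.trans ((h3.mul_right_eq_zero).mp h2.symm)
  refine ⟨AdjoinRoot.liftAlgHom _ j v hroot, ?_, ?_⟩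
  · exact (congrArg (x F ^ b * ·) (AdjoinRoot.liftAlgHom_of _ _ _ _ _)).trans hju
  · exact (congrArg (· * x F ^ a) (AdjoinRoot.liftAlgHom_root _ _ _ _)).trans hv

/-- Integrality at infinity bounds the weighted degree: an element of the function field that is
integral over `K[x⁻¹]` has weighted degree at most `0`, where `x` has weight `b` and `y` has
weight `a`. -/
theorem weight_le_of_isIntegral (hb : 0 < b) (hf : f.Monic) (hd : f.natDegree = b)
    (hs : SupportedInTriangle a b f)
    (he : ((weightedReflect (a * b) a b f).map constantCoeff).Separable)
    {s z : PlaneFunctionField f} (hsx : s * x f = 1)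
    (hz : IsIntegral (Algebra.adjoin K {s}) z) {n : ℕ}
    {P : K[X][Y]} (hP : P.natDegree < b) (hPz : x f ^ n * z = evalAt (algebraMap K _) (x f) (y f) P)
    {i j : ℕ} (hij : (P.coeff j).coeff i ≠ 0) : b * i + a * j ≤ b * n := by
  let F := weightedReflect (a * b) a b f
  obtain ⟨ψ, hx, hy⟩ : ∃ ψ : PlaneFunctionField f →ₐ[K] PlaneFunctionField F,
    x F ^ b * ψ (x f) = 1 ∧ ψ (y f) * x F ^ a = y F := exists_ringHom_weightedReflect hb hs
  have hFm : F.Monic := monic_weightedReflect hf hd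
  have hFd : F.degree = b := by
    rw [degree_eq_natDegree hFm.ne_zero]
    refine congrArg _ (natDegree_eq_of_le_of_coeff_ne_zero (natDegree_weightedReflect hd) ?_)
    rw [coeff_weightedReflect_natDegree hf hd]
    exact one_ne_zero
  have hunit : IsUnit (x F) := IsUnit.of_mul_eq_one_right _ x_inv_mul_x
  have hint : IsIntegral K[X] (ψ z) := by
    obtain ⟨p, hp, hpz⟩ := exists_monic_of_isIntegral_adjoin hz
    have hψs : ψ s = x F ^ b := by
      have h1 : ψ s * ψ (x f) = 1 := by rw [← map_mul, hsx, map_one]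
      calc ψ s = ψ s * (x F ^ b * ψ (x f)) := by rw [hx, mul_one]
        _ = x F ^ b * (ψ s * ψ (x f)) := by ring
        _ = _ := by rw [h1, mul_one]
    refine ⟨p.map (eval₂RingHom C (X ^ b)), hp.map _, ?_⟩
    have h1 := congrArg (ψ : PlaneFunctionField f →+* PlaneFunctionField F) hpz
    rw [map_evalAt, map_zero, AlgHom.comp_algebraMap] at h1
    rw [eval₂_map, ← h1, evalAt, coe_eval₂RingHom]
    congr 1
    ext c
    · simp [algebraMap_polynomial]
    · simp [algebraMap_polynomial, hψs]
  -- `M` bounds the weights of all monomials of `P`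
  obtain ⟨M, hMn, hM⟩ : ∃ M, b * n ≤ M ∧ ∀ i j, (P.coeff j).coeff i ≠ 0 → b * i + a * j ≤ M := by
    refine ⟨b * n + b * (P.support.sup fun j => (P.coeff j).natDegree) + a * P.natDegree,
      by omega, fun i j h => ?_⟩
    have h1 : j ∈ P.support := by
      rw [mem_support_iff]
      intro h0
      simp [h0] at h
    have h2 : i ≤ P.support.sup fun j => (P.coeff j).natDegree :=
      (le_natDegree_of_ne_zero h).trans (Finset.le_sup (f := fun j => (P.coeff j).natDegree) h1)
    have h3 := Nat.mul_le_mul_left b h2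
    have h4 := Nat.mul_le_mul_left a (le_natDegree_of_mem_supp _ h1)
    omega
  let w := weightedReflect M a b P
  have hw : x F ^ (M - b * n) * ψ z = aeval (y F) w := by
    have h1 := evalAt_weightedReflect (algebraMap K _) (v := ψ (y f)) hx hM
    rw [hy] at h1
    have h2 := congrArg (ψ : PlaneFunctionField f →+* PlaneFunctionField F) hPz
    rw [map_evalAt, AlgHom.comp_algebraMap, map_mul, map_pow] at h2
    rw [aeval_y_eq_evalAt]
    refine Eq.trans ?_ h1.symm
    refine Eq.trans ?_ (congrArg (x F ^ M * ·) h2)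
    obtain ⟨m, rfl⟩ := Nat.exists_eq_add_of_le hMn
    rw [Nat.add_sub_cancel_left, pow_add, pow_mul]
    change _ = (x F ^ b) ^ n * x F ^ m * (ψ (x f) ^ n * ψ z)
    calc _ = (x F ^ b * ψ (x f)) ^ n * (x F ^ m * ψ z) := by rw [hx, one_pow, one_mul]
      _ = _ := by ring
  have halg : algebraMap K[X] (PlaneFunctionField F) X = x F := by
    rw [algebraMap_polynomial, eval₂_X]
  obtain ⟨w₁, hw₁⟩ := exists_aeval_eq_of_isIntegral (constantCoeff : K[X] →+* K) (π := X) (by simp)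
    (fun c hc => X_dvd_iff.mpr hc) hFm he.squarefree (t := y F)
    (fun g => by rw [aeval_y_eq_evalAt, evalAt_eq_zero_iff hFm])
    (fun c hc => by
      rw [halg] at hc
      exact (hunit.mul_right_eq_zero).mp hc) hint (M - b * n) w (by rw [halg, hw])
  have hww : w = C (X ^ (M - b * n)) * (w₁ %ₘ F) := by
    refine eq_of_evalAt_eq hFm ?_ ?_ ?_
    · rw [hFd, degree_lt_iff_coeff_zero]
      intro k hk
      rw [coeff_weightedReflect, coeff_eq_zero_of_natDegree_lt (by omega), sum_zero_index]
    · rw [← smul_eq_C_mul]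
      exact (degree_smul_le _ _).trans_lt (degree_modByMonic_lt _ hFm)
    · rw [map_mul, evalAt_C, eval₂_pow, eval₂_X, evalAt_modByMonic, ← aeval_y_eq_evalAt,
        ← aeval_y_eq_evalAt, hw₁, hw]
  have hcoef : (w.coeff j).coeff (M - b * i - a * j) = (P.coeff j).coeff i := by
    have hMi := hM i j hij
    rw [coeff_weightedReflect, Polynomial.sum_def, finsetSum_coeff, Finset.sum_eq_single i]
    · rw [coeff_monomial, if_pos rfl]
    · intro i' hi' hne
      rw [coeff_monomial, if_neg]
      intro h
      have hMi' := hM i' j (mem_support_iff.mp hi')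
      exact hne (Nat.eq_of_mul_eq_mul_left hb (by omega))
    · intro h
      rw [notMem_support_iff.mp h, map_zero, coeff_zero]
  by_contra hlt
  have hMi := hM i j hij
  rw [hww, coeff_C_mul, coeff_X_pow_mul', if_neg (by omega)] at hcoef
  exact hij hcoef.symm

end Infinity

/-! ### The integral basis -/

section IntegralBasis

open PlaneFunctionField

variable {K : Type*} [Field K] {f : K[X][Y]}

namespace PlaneFunctionField

/-- The element `x ^ m` of the function field, for an integer `m`. -/
noncomputable def xZPow (f : K[X][Y]) (m : ℤ) : PlaneFunctionField f :=
  algebraMap (RatFunc K) (PlaneFunctionField f) (RatFunc.X ^ m)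

theorem xZPow_add (m n : ℤ) : xZPow f (m + n) = xZPow f m * xZPow f n := by
  rw [xZPow, zpow_add₀ RatFunc.X_ne_zero, map_mul]; rfl

theorem xZPow_natCast (n : ℕ) : xZPow f n = x f ^ n := by
  rw [xZPow, zpow_natCast, map_pow]

theorem xZPow_zero : xZPow f 0 = 1 := by rw [xZPow, zpow_zero, map_one]

theorem xZPow_neg_one_mul_x : xZPow f (-1) * x f = 1 := by
  rw [xZPow, zpow_neg_one, x_inv_mul_x]

theorem xZPow_mem_adjoin {m : ℤ} (hm : m ≤ 0) :
    xZPow f m ∈ Algebra.adjoin K {xZPow f (-1)} := by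
  obtain ⟨k, rfl⟩ : ∃ k : ℕ, m = -k := ⟨m.natAbs, by omega⟩
  have : xZPow f (-k) = xZPow f (-1) ^ k := by
    rw [xZPow, xZPow, ← map_pow, ← zpow_natCast, ← zpow_mul, neg_one_mul]
  rw [this]
  exact pow_mem (Algebra.self_mem_adjoin_singleton _ _) k

theorem exists_evalAt_eq_of_mem_adjoin {z : PlaneFunctionField f}
    (hz : z ∈ Algebra.adjoin K {x f, y f}) :
    ∃ P : K[X][Y], evalAt (algebraMap K _) (x f) (y f) P = z := by
  induction hz using Algebra.adjoin_induction with
  | mem w hw =>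
    rcases hw with rfl | rfl
    · exact ⟨C X, by simp⟩
    · exact ⟨X, by simp⟩
  | algebraMap r => exact ⟨C (C r), by simp⟩
  | add z w _ _ hz hw =>
    obtain ⟨P, rfl⟩ := hz
    obtain ⟨Q, rfl⟩ := hw
    exact ⟨P + Q, map_add _ _ _⟩
  | mul z w _ _ hz hw =>
    obtain ⟨P, rfl⟩ := hz
    obtain ⟨Q, rfl⟩ := hw
    exact ⟨P * Q, map_mul _ _ _⟩

theorem adjoin_x_y_eq_top [Fact (Irreducible (f.map (algebraMap K[X] (RatFunc K))))] :
    IntermediateField.adjoin K {x f, y f} = ⊤ := by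
  refine top_le_iff.mp fun z _ => ?_
  have hx : x f ∈ IntermediateField.adjoin K {x f, y f} :=
    IntermediateField.subset_adjoin _ _ (by simp)
  have hy : y f ∈ IntermediateField.adjoin K {x f, y f} :=
    IntermediateField.subset_adjoin _ _ (by simp)
  have hp : ∀ p : K[X], algebraMap (RatFunc K) (PlaneFunctionField f) (algebraMap K[X] _ p) ∈
      IntermediateField.adjoin K {x f, y f} := fun p => by
    rw [← IsScalarTower.algebraMap_apply, algebraMap_polynomial, eval₂_eq_sum]
    exact sum_mem fun i _ => mul_mem (algebraMap_mem _ _) (pow_mem hx i)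
  have hr : ∀ r : RatFunc K, algebraMap (RatFunc K) (PlaneFunctionField f) r ∈
      IntermediateField.adjoin K {x f, y f} := fun r => by
    obtain ⟨p, q, -, rfl⟩ := IsFractionRing.div_surjective (A := K[X]) r
    rw [map_div₀]
    exact div_mem (hp p) (hp q)
  obtain ⟨g, rfl⟩ := AdjoinRoot.mk_surjective z
  rw [← AdjoinRoot.aeval_eq, aeval_eq_sum_range]
  refine sum_mem fun i _ => ?_
  rw [Algebra.smul_def]
  exact mul_mem (hr _) (pow_mem hy i)

end PlaneFunctionField

variable {a b : ℕ}

/-- The exponent of `x` in the `j`-th element of the integral basis. -/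
noncomputable def basisExponent (a b j : ℕ) : ℤ := ⌊-((j : ℕ) * a : ℚ) / b⌋

theorem le_basisExponent_iff (hb : 0 < b) {j : ℕ} {m : ℤ} :
    m ≤ basisExponent a b j ↔ b * m + a * j ≤ 0 := by
  have hb' : (0 : ℚ) < b := by exact_mod_cast hb
  rw [basisExponent, Int.le_floor, le_div_iff₀ hb']
  constructor
  · intro h
    have : (b * m + a * j : ℚ) ≤ 0 := by linarith
    exact_mod_cast this
  · intro h
    have : (b * m + a * j : ℚ) ≤ 0 := by exact_mod_cast h
    linarith

/-- The `j`-th element `x ^ ⌊-j * a / b⌋ * y ^ j` of the integral basis. -/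
noncomputable def basisElt (f : K[X][Y]) (a b : ℕ) (j : Fin b) : PlaneFunctionField f :=
  xZPow f (basisExponent a b j) * y f ^ (j : ℕ)

/-- All monomials of nonpositive weight lie in the span of the basis elements: powers of `y` with
exponent at least `b` are rewritten by the equation of the curve, which does not increase the
weight because `f` is supported in the triangle. -/
theorem xZPow_mul_pow_mem_span (hb : 0 < b) (hf : f.Monic) (hd : f.natDegree = b)
    (hs : SupportedInTriangle a b f) (n : ℕ) :
    ∀ m : ℤ, b * m + a * n ≤ 0 → xZPow f m * y f ^ n ∈
      Submodule.span (Algebra.adjoin K {xZPow f (-1)}) (Set.range (basisElt f a b)) := by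
  induction n using Nat.strong_induction_on with
  | _ n ih =>
    intro m hm
    set N := Submodule.span (Algebra.adjoin K {xZPow f (-1)}) (Set.range (basisElt f a b))
    by_cases hn : n < b
    · have hle := (le_basisExponent_iff hb).mpr hm
      have h1 : xZPow f m * y f ^ n =
          (⟨xZPow f (m - basisExponent a b n), xZPow_mem_adjoin (by omega)⟩ :
            Algebra.adjoin K {xZPow f (-1)}) • basisElt f a b ⟨n, hn⟩ := by
        rw [Algebra.smul_def, basisElt, ← mul_assoc]
        change _ = xZPow f (m - basisExponent a b n) * xZPow f (basisExponent a b n) * _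
        rw [← xZPow_add, sub_add_cancel]
      rw [h1]
      exact N.smul_mem _ (Submodule.subset_span ⟨_, rfl⟩)
    · obtain ⟨l, rfl⟩ := Nat.exists_eq_add_of_le (not_lt.mp hn)
      have h0 : y f ^ b = -∑ j ∈ Finset.range b, (f.coeff j).sum fun i r =>
          algebraMap K (PlaneFunctionField f) r * (x f ^ i * y f ^ j) := by
        have h1 := evalAt_self (f := f)
        conv_lhs at h1 => enter [2]; rw [hf.as_sum]
        rw [hd] at h1
        simp only [map_add, map_pow, evalAt_X, map_sum, map_mul, evalAt_C] at h1
        rw [eq_neg_of_add_eq_zero_left h1]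
        congr 1
        refine Finset.sum_congr rfl fun j _ => ?_
        rw [eval₂_eq_sum, Polynomial.sum_def, Polynomial.sum_def, Finset.sum_mul]
        exact Finset.sum_congr rfl fun i _ => mul_assoc _ _ _
      rw [pow_add, h0, neg_mul, mul_neg, Finset.sum_mul, Finset.mul_sum]
      refine N.neg_mem (N.sum_mem fun j hj => ?_)
      rw [Polynomial.sum_def, Finset.sum_mul, Finset.mul_sum]
      refine N.sum_mem fun i hi => ?_
      have hij := hs i j (mem_support_iff.mp hi)
      have hjb := Finset.mem_range.mp hj
      have h2 := ih (l + j) (by omega) (m + i) (by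
        zify at hij
        push_cast at hm ⊢
        linarith)
      have h3 : xZPow f m * (algebraMap K (PlaneFunctionField f) ((f.coeff j).coeff i) *
          (x f ^ i * y f ^ j) * y f ^ l) =
          algebraMap K (Algebra.adjoin K {xZPow f (-1)}) ((f.coeff j).coeff i) •
            (xZPow f (m + i) * y f ^ (l + j)) := by
        rw [algebraMap_smul, Algebra.smul_def, xZPow_add, xZPow_natCast, pow_add]
        ring
      rw [h3]
      exact N.smul_mem _ h2

/-- The span of the basis elements is a ring, finite over `K[x⁻¹]`. -/
theorem span_basisElt_le_integralClosure [IsDomain (PlaneFunctionField f)] (hb : 0 < b)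
    (hf : f.Monic) (hd : f.natDegree = b) (hs : SupportedInTriangle a b f) :
    Submodule.span (Algebra.adjoin K {xZPow f (-1)}) (Set.range (basisElt f a b)) ≤
      Subalgebra.toSubmodule
        (integralClosure (Algebra.adjoin K {xZPow f (-1)}) (PlaneFunctionField f)) := by
  set N := Submodule.span (Algebra.adjoin K {xZPow f (-1)}) (Set.range (basisElt f a b)) with hN
  rw [hN, Submodule.span_le]
  rintro _ ⟨j, rfl⟩
  refine isIntegral_of_smul_mem_submodule (M := PlaneFunctionField f) N ?_
    (Submodule.fg_span (Set.finite_range _)) _ fun z hz => ?_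
  · rw [Submodule.ne_bot_iff]
    refine ⟨1, ?_, one_ne_zero⟩
    have h := xZPow_mul_pow_mem_span hb hf hd hs 0 0 (by simp)
    rwa [xZPow_zero, pow_zero, one_mul] at h
  · induction hz using Submodule.span_induction with
    | mem w hw =>
      obtain ⟨k, rfl⟩ := hw
      have h1 := (le_basisExponent_iff hb (a := a) (j := j)).mp le_rfl
      have h2 := (le_basisExponent_iff hb (a := a) (j := k)).mp le_rfl
      have h3 := xZPow_mul_pow_mem_span hb hf hd hs (j + k)
        (basisExponent a b j + basisExponent a b k) (by push_cast; linarith)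
      rw [xZPow_add, pow_add] at h3
      rw [smul_eq_mul, basisElt, basisElt]
      convert h3 using 1
      ring
    | zero => rw [smul_zero]; exact N.zero_mem
    | add w w' _ _ hw hw' => rw [smul_add]; exact N.add_mem hw hw'
    | smul r w _ hw =>
      rw [smul_comm]
      exact N.smul_mem r hw

/-- As a polynomial in `x`, the equation of the curve is monic up to the coefficient at the vertex
`(a, 0)`. -/
theorem monic_C_mul_swap (ha : 0 < a) (hb : 0 < b) (hs : SupportedInTriangle a b f)
    (hc : (f.coeff 0).coeff a ≠ 0) :
    (C (C ((f.coeff 0).coeff a)⁻¹) * Bivariate.swap f).Monic := by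
  refine monic_of_natDegree_le_of_coeff_eq_one a ?_ ?_
  · refine natDegree_le_iff_coeff_eq_zero.mpr fun i hi => ?_
    ext j
    rw [coeff_C_mul, coeff_C_mul, coeff_coeff_swap, coeff_zero]
    by_contra h
    have h1 := hs i j (right_ne_zero_of_mul h)
    have h2 : b * a < b * i := Nat.mul_lt_mul_of_pos_left hi hb
    rw [mul_comm b a] at h2
    omega
  · ext j
    rw [coeff_C_mul, coeff_C_mul, coeff_coeff_swap, coeff_one]
    split_ifs with hj
    · subst hj
      exact inv_mul_cancel₀ hc
    · by_contra h
      have h1 := hs a j (right_ne_zero_of_mul h)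
      have h2 : 0 < a * j := Nat.mul_pos ha (by omega)
      rw [mul_comm b a] at h1
      omega

/-- An integral element times a power of `x` is a polynomial in `x` and `y` by normality of the
affine curve, and the weights of its monomials are bounded by normality at infinity. -/
theorem integralClosure_le_span_basisElt [CharZero K]
    [Fact (Irreducible (f.map (algebraMap K[X] (RatFunc K))))] (ha : 0 < a) (hb : 0 < b)
    (hf : f.Monic) (hd : f.natDegree = b) (hs : SupportedInTriangle a b f)
    (hc : (f.coeff 0).coeff a ≠ 0) (hsm : Ideal.span {f, partialX f, partialY f} = ⊤)
    (he : ((weightedReflect (a * b) a b f).map constantCoeff).Separable) :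
    Subalgebra.toSubmodule
        (integralClosure (Algebra.adjoin K {xZPow f (-1)}) (PlaneFunctionField f)) ≤
      Submodule.span (Algebra.adjoin K {xZPow f (-1)}) (Set.range (basisElt f a b)) := by
  intro z hz
  have hz : IsIntegral (Algebra.adjoin K {xZPow f (-1)}) z := hz
  have hf' := monic_C_mul_swap ha hb hs hc
  obtain ⟨n, hn⟩ := exists_pow_mul_isIntegral xZPow_neg_one_mul_x hz
  have h1 : x f ^ n * z ∈ Algebra.adjoin K {x f, y f} := by
    refine mem_adjoin_of_isIntegral adjoin_x_y_eq_top hf (inv_ne_zero hc) hf'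
      evalAt_self hsm (hn _ ?_) (hn _ ?_)
    · exact isIntegral_algebraMap
        (x := (⟨x f, Algebra.self_mem_adjoin_singleton K _⟩ : Algebra.adjoin K {x f}))
    · exact isIntegral_adjoin_of_monic hf' (by rw [map_mul, evalAt_swap, evalAt_self, mul_zero])
  obtain ⟨P₀, hP₀⟩ := exists_evalAt_eq_of_mem_adjoin h1
  rw [← evalAt_modByMonic] at hP₀
  set P := P₀ %ₘ f
  have hP : P.natDegree < b := by
    rw [← hd]
    exact natDegree_modByMonic_lt P₀ hf fun h => by rw [h, natDegree_one] at hd; omega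
  have hw := fun i j hij => weight_le_of_isIntegral (i := i) (j := j) hb hf hd hs he
    xZPow_neg_one_mul_x hz hP hP₀.symm hij
  have hz' : z = xZPow f (-n) * evalAt (algebraMap K _) (x f) (y f) P := by
    rw [hP₀, ← xZPow_natCast, ← mul_assoc, ← xZPow_add, neg_add_cancel, xZPow_zero, one_mul]
  rw [hz', evalAt_eq_sum, Polynomial.sum_def, Finset.mul_sum]
  refine Submodule.sum_mem _ fun j _ => ?_
  rw [Polynomial.sum_def, Finset.mul_sum]
  refine Submodule.sum_mem _ fun i hi => ?_
  have h2 : xZPow f (-n) * (algebraMap K (PlaneFunctionField f) ((P.coeff j).coeff i) *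
      x f ^ i * y f ^ j) = algebraMap K (Algebra.adjoin K {xZPow f (-1)}) ((P.coeff j).coeff i) •
        (xZPow f (-n + i) * y f ^ j) := by
    rw [algebraMap_smul, Algebra.smul_def, xZPow_add, xZPow_natCast]
    ring
  rw [h2]
  refine Submodule.smul_mem _ _ (xZPow_mul_pow_mem_span hb hf hd hs j _ ?_)
  have h3 := hw i j (mem_support_iff.mp hi)
  zify at h3
  linarith

theorem linearIndependent_basisElt (hf : f.Monic) (hd : f.natDegree = b) :
    LinearIndependent (Algebra.adjoin K {xZPow f (-1)}) (basisElt f a b) := by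
  have hr : ∀ r : Algebra.adjoin K {xZPow f (-1)}, ∃ ρ : RatFunc K,
      algebraMap (RatFunc K) (PlaneFunctionField f) ρ = r :=
    fun r => (Algebra.adjoin_le (S := (IsScalarTower.toAlgHom K (RatFunc K)
      (PlaneFunctionField f)).range) (Set.singleton_subset_iff.mpr ⟨_, rfl⟩)) r.2
  choose ρ hρ using hr
  rw [Fintype.linearIndependent_iff]
  intro g hg j
  let G : (RatFunc K)[X] :=
    ∑ i : Fin b, monomial (i : ℕ) (ρ (g i) * RatFunc.X ^ basisExponent a b i)
  have hG : AdjoinRoot.mk (f.map (algebraMap K[X] (RatFunc K))) G = 0 := by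
    rw [← hg, map_sum]
    refine Finset.sum_congr rfl fun i _ => ?_
    rw [← C_mul_X_pow_eq_monomial, map_mul, map_pow, AdjoinRoot.mk_X, AdjoinRoot.mk_C, map_mul,
      Algebra.smul_def, basisElt, ← mul_assoc]
    exact congrArg (· * _ * _) (hρ (g i))
  rw [AdjoinRoot.mk_eq_zero] at hG
  have hG0 : G = 0 := by
    refine eq_zero_of_dvd_of_degree_lt hG ?_
    rw [degree_eq_natDegree (hf.map _).ne_zero, hf.natDegree_map, hd, degree_lt_iff_coeff_zero]
    intro k hk
    rw [finsetSum_coeff]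
    exact Finset.sum_eq_zero fun i _ => coeff_monomial_of_ne _ (by have := i.2; omega)
  have hj : ρ (g j) * RatFunc.X ^ basisExponent a b j = 0 := by
    have h1 := congrArg (fun p => coeff p (j : ℕ)) hG0
    simp only [G, finsetSum_coeff, coeff_monomial, coeff_zero, Fin.val_inj] at h1
    simpa using h1
  have h2 : ρ (g j) = 0 := (mul_eq_zero.mp hj).resolve_right (zpow_ne_zero _ RatFunc.X_ne_zero)
  refine Subtype.ext ?_
  rw [← hρ, h2, map_zero]
  rfl

/-- The integral basis of a smooth plane curve with separable edge polynomial. The equation `g` of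
the function field over `K(x)` is kept as a separate variable. -/
theorem isIntegralBasis_of_smooth [CharZero K] (ha : 0 < a) (hb : 0 < b)
    (hf : f.Monic) (hd : f.natDegree = b) (hs : SupportedInTriangle a b f)
    (hc : (f.coeff 0).coeff a ≠ 0) (hsm : Ideal.span {f, partialX f, partialY f} = ⊤)
    (he : ((weightedReflect (a * b) a b f).map constantCoeff).Separable)
    {g : (RatFunc K)[X]} (hg : f.map (algebraMap K[X] (RatFunc K)) = g)
    (hirr : IsField (AdjoinRoot g)) :
    IsIntegralBasis
      (Algebra.adjoin K {algebraMap (RatFunc K) (AdjoinRoot g) (RatFunc.X ^ (-1 : ℤ))})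
      (fun j : Fin b => algebraMap (RatFunc K) (AdjoinRoot g)
        (RatFunc.X ^ ⌊-((j : ℕ) * a : ℚ) / b⌋) * AdjoinRoot.root g ^ (j : ℕ)) := by
  subst hg
  have : Fact (Irreducible (f.map (algebraMap K[X] (RatFunc K)))) := ⟨by
    have h1 : (Ideal.span {f.map (algebraMap K[X] (RatFunc K))}).IsMaximal :=
      Ideal.Quotient.maximal_of_isField _ hirr
    exact ((Ideal.span_singleton_prime (hf.map _).ne_zero).mp h1.isPrime).irreducible⟩
  exact ⟨linearIndependent_basisElt hf hd,
    le_antisymm (span_basisElt_le_integralClosure hb hf hd hs)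
      (integralClosure_le_span_basisElt ha hb hf hd hs hc hsm he)⟩

end IntegralBasis

/-! ### Witt vectors and the change of basis -/

section Lift

variable (p : ℕ) [Fact p.Prime] (F : Type*) [Field F] [CharP F p]

theorem isLocalRing_Zq [Finite F] : IsLocalRing (Zq p F) := by
  have : PerfectRing F p := inferInstance
  infer_instance

theorem charZero_Qq : CharZero (Qq p F) := by
  have h1 : (p : Zq p F) ≠ 0 := WittVector.p_nonzero p F
  have h2 : CharZero (Zq p F) := by
    obtain ⟨q, hq⟩ := CharP.exists (Zq p F)
    rcases CharP.char_is_prime_or_zero (Zq p F) q with hp | rfl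
    · -- a positive characteristic would be that of the residue field
      have h3 : ((q : ℕ) : F) = 0 := by
        rw [← map_natCast (WittVector.constantCoeff : Zq p F →+* F), CharP.cast_eq_zero, map_zero]
      have h4 : p ∣ q := (CharP.cast_eq_zero_iff F p q).mp h3
      obtain rfl := (Nat.prime_dvd_prime_iff_eq Fact.out hp).mp h4
      exact absurd (CharP.cast_eq_zero (Zq p F) p) h1
    · exact CharP.charP_to_charZero _
  exact charZero_of_injective_algebraMap (IsFractionRing.injective (Zq p F) (Qq p F))

variable {p F}

theorem laurentElt_T (f : (Zq p F)[X][Y]) (m : ℤ) :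
    laurentElt f (LaurentPolynomial.T m) = xPow f m := by
  rw [laurentElt, RingHom.comp_apply, LaurentPolynomial.eval₂_T, Units.val_zpow_eq_zpow_val,
    Units.val_mk0]
  rfl

/-- Multiplying the powers of `y` by powers of `x` is an invertible diagonal change of basis over
the Laurent polynomials. -/
theorem exists_GL_laurent (f : (Zq p F)[X][Y]) {b : ℕ} (e : Fin b → ℤ) :
    ∃ W : GL (Fin b) (Zq p F)[T;T⁻¹], ∀ j : Fin b,
      ∑ i : Fin b, laurentElt f ((W : Matrix (Fin b) (Fin b) (Zq p F)[T;T⁻¹]) i j)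
        * yElt f ^ (i : ℕ) = xPow f (e j) * yElt f ^ (j : ℕ) := by
  have h : ∀ e : Fin b → ℤ,
      Matrix.diagonal (fun j => (LaurentPolynomial.T (e j) : (Zq p F)[T;T⁻¹])) *
        Matrix.diagonal (fun j => LaurentPolynomial.T (-e j)) = 1 := fun e => by
    rw [Matrix.diagonal_mul_diagonal, ← Matrix.diagonal_one]
    congr 1
    funext j
    rw [← LaurentPolynomial.T_add, add_neg_cancel, LaurentPolynomial.T_zero]
  refine ⟨⟨Matrix.diagonal fun j => LaurentPolynomial.T (e j),
    Matrix.diagonal fun j => LaurentPolynomial.T (-e j), h e, ?_⟩, fun j => ?_⟩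
  · have h' := h fun j => -e j
    simp only [neg_neg] at h'
    exact h'
  · change ∑ i : Fin b, laurentElt f ((Matrix.diagonal fun j => LaurentPolynomial.T (e j) :
      Matrix (Fin b) (Fin b) (Zq p F)[T;T⁻¹]) i j) * yElt f ^ (i : ℕ) = _
    rw [Finset.sum_eq_single j]
    · rw [Matrix.diagonal_apply_eq, laurentElt_T]
    · intro i _ hij
      rw [Matrix.diagonal_apply_ne _ hij, map_zero, zero_mul]
    · exact fun h => absurd (Finset.mem_univ j) h

end Lift

theorem mainTheorem12 (p : ℕ) [Fact p.Prime] (F : Type*) [Field F] [Finite F] [CharP F p]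
    (Q : F[X][Y]) (hQirr : Irreducible Q) (hQmonic : Q.Monic)
    (𝒬 : (Zq p F)[X][Y]) (hlift : reduceMod p F 𝒬 = Q) (hmonic : 𝒬.Monic)
    (hsupp : ∀ i j : ℕ, (𝒬.coeff j).coeff i ≠ 0 ↔ (Q.coeff j).coeff i ≠ 0)
    (a b : ℕ) (ha : 0 < a) (hb : 0 < b)
    (hnd : IsNondegenerate Q (triangle a b)) :
    Q.natDegree = b ∧
    IsIntegralBasis (polyInvX 𝒬)
      (fun j : Fin b => xPow 𝒬 ⌊-((j : ℕ) * a : ℚ) / b⌋ * yElt 𝒬 ^ (j : ℕ)) ∧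
    ∃ W : GL (Fin b) (Zq p F)[T;T⁻¹], ∀ j : Fin b,
      ∑ i : Fin b, laurentElt 𝒬 ((W : Matrix (Fin b) (Fin b) (Zq p F)[T;T⁻¹]) i j)
          * yElt 𝒬 ^ (i : ℕ)
        = xPow 𝒬 ⌊-((j : ℕ) * a : ℚ) / b⌋ * yElt 𝒬 ^ (j : ℕ) := by
  have := isLocalRing_Zq p F
  have := charZero_Qq p F
  subst hlift
  have hnd' : IsNondegenerate (𝒬.map (mapRingHom (WittVector.constantCoeff : Zq p F →+* F)))
    (triangle a b) := hnd
  have hρ : Function.Surjective (WittVector.constantCoeff : Zq p F →+* F) :=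
    WittVector.constantCoeff_surjective p
  have hs : SupportedInTriangle a b 𝒬 := fun i j hij =>
    hnd.supportedInTriangle i j ((hsupp i j).mp hij)
  have hd : 𝒬.natDegree = b := by rw [← hnd'.natDegree_eq ha hb, hmonic.natDegree_map]
  have hinj := IsFractionRing.injective (Zq p F) (Qq p F)
  have hc : ((𝒬.map (mapRingHom (algebraMap (Zq p F) (Qq p F)))).coeff 0).coeff a ≠ 0 := by
    rw [coeff_map, coe_mapRingHom, coeff_map, Ne, map_eq_zero_iff _ hinj]
    exact (hsupp a 0).mpr (hnd.coeff_zero_coeff_ne_zero ha hb)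
  refine ⟨hnd.natDegree_eq ha hb, ?_, exists_GL_laurent 𝒬 fun j => ⌊-((j : ℕ) * a : ℚ) / b⌋⟩
  exact isIntegralBasis_of_smooth ha hb (hmonic.map _) (by rw [hmonic.natDegree_map, hd])
    (hs.map (algebraMap (Zq p F) (Qq p F))) hc
    (span_eq_top_of_isNondegenerate_map _ hρ ha hb hmonic hs hnd')
    (separable_edge_of_isNondegenerate_map _ hρ ha hb hmonic hs hnd')
    (Polynomial.map_map _ _ _) (isField_curveFunctionField hmonic hQirr)
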